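/- **Theorem 5.4 (with Lemma 5.3).** For an integer $d\ge 0$ and real $\mu$, let $S_d(\mu)=\{x\in\{\pm1\}^d:\ \sum_{i=1}^d x_i=\mu d\}$ be the Boolean slice of mean $\mu$. For integers $d_1,d_2,d_3\ge 0$ and real $\mu,\nu$ such that $S_{d_2}(\mu)$ and $S_{d_3}(\nu)$ are nonempty, let $d=d_1+d_2+d_3$ and let $\pi=\pi^s_{\mu,\nu;d_1,d_2,d_3}$ be the law of $x=(x_1,x_2,x_3)\in\{\pm1\}^d$, where $x_1,x_2,x_3$ are independent and uniformly distributed on $\{\pm1\}^{d_1}$, $S_{d_2}(\mu)$ and $S_{d_3}(\nu)$ respectively. Let $m=(0,\dots,0,\mu,\dots,\mu,\nu,\dots,\nu)\in\mathbb{R}^d$, with $d_1$ entries $0$, $d_2$ entries $\mu$ and $d_3$ entries $\nu$. Below, $\|v\|$ is the Euclidean norm, $\|\mathbf A\|_{\mathsf{op}}$ the Euclidean operator norm, and $\|\mathbf A\|_F$ the Frobenius norm. 1. (Linear forms.) There is an absolute constant $c_0>0$ such that for all such $d_1,d_2,d_3,\mu,\nu$, every nonzero $v\in\mathbb{R}^d$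 and every $t>0$, $$\Pr_{x\sim\pi}\bigl[\,|\langle v,x\rangle-\langle v,m\rangle|\ge t\,\bigr]\le 2\exp\bigl(-c_0\,t^2/\|v\|^2\bigr).$$ 2. (Quadratic forms.) For every constant $c>0$ there are constants $C,K>0$, depending only on $c$, such that for all such $d_1,d_2,d_3,\mu,\nu$ with $|\mu|\sqrt{d_2}\le c$ and $|\nu|\sqrt{d_3}\le c$, every nonzero matrix $\mathbf A\in\mathbb{R}^{d\times d}$ and every $t>0$, $$\Pr_{x\sim\pi}\Bigl[\,\bigl|x^\top\mathbf A x-\mathbb{E}_{y\sim\pi}[y^\top\mathbf A y]\bigr|>t\,\Bigr]\le K\exp\Bigl(-C\min\Bigl(\frac{t}{\|\mathbf A\|_{\mathsf{op}}},\frac{t^2}{\|\mathbf A\|_F^2}\Bigr)\Bigr).$$ (For $v=0$ or $\mathbf A=0$ the form is identically $0$ and the probability is $0$.) -/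

import Mathlib

open MeasureTheory ProbabilityTheory Matrix

/-- The Boolean cube `{±1}^d`, as a set of real vectors. -/
def boolCube (d : ℕ) : Set (Fin d → ℝ) :=
  {x | ∀ i, x i = 1 ∨ x i = -1}

/-- The Boolean slice: the strings in `{±1}^d` whose average is `μ`. The condition
`(1/d) ∑ i, x i = μ` is written with the denominator cleared, so that for `d = 0` the slice is
the one-point set consisting of the empty string. -/
def boolSlice (d : ℕ) (μ : ℝ) : Set (Fin d → ℝ) :=
  {x | x ∈ boolCube d ∧ ∑ i, x i = μ * d}

/-- The `d = d₁ + d₂ + d₃` coordinates, split into three consecutive blocks. -/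
abbrev BlockIdx (d₁ d₂ d₃ : ℕ) : Type := Fin d₁ ⊕ (Fin d₂ ⊕ Fin d₃)

/-- Concatenation of three block vectors into one vector of length `d₁ + d₂ + d₃`. -/
def concatBlocks {d₁ d₂ d₃ : ℕ} (p : (Fin d₁ → ℝ) × (Fin d₂ → ℝ) × (Fin d₃ → ℝ)) :
    BlockIdx d₁ d₂ d₃ → ℝ :=
  Sum.elim p.1 (Sum.elim p.2.1 p.2.2)

/-- The law of `x = (x₁, x₂, x₃)` with independent blocks, `x₁` uniform on the cube `{±1}^{d₁}`,
`x₂` uniform on the slice of `{±1}^{d₂}` of mean `μ`, and `x₃` uniform on the slice of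
`{±1}^{d₃}` of mean `ν`. -/
noncomputable def cubeSliceLaw (d₁ d₂ d₃ : ℕ) (μ ν : ℝ) : Measure (BlockIdx d₁ d₂ d₃ → ℝ) :=
  ((uniformOn (boolCube d₁)).prod
    ((uniformOn (boolSlice d₂ μ)).prod (uniformOn (boolSlice d₃ ν)))).map concatBlocks

/-- The vector `μ • 1_[2] + ν • 1_[3]`: zero on the first block, `μ` on the second one and `ν` on
the third one. -/
def blockMean (d₁ d₂ d₃ : ℕ) (μ ν : ℝ) : BlockIdx d₁ d₂ d₃ → ℝ :=
  Sum.elim (fun _ => 0) (Sum.elim (fun _ => μ) (fun _ => ν))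

/-- The operator norm of a real square matrix with respect to the Euclidean norm. -/
noncomputable def matOpNorm {ι : Type*} [Fintype ι] [DecidableEq ι] (A : Matrix ι ι ℝ) : ℝ :=
  ‖Matrix.toEuclideanCLM (n := ι) (𝕜 := ℝ) A‖

/-- The Frobenius norm of a real square matrix. -/
noncomputable def matFrobNorm {ι : Type*} [Fintype ι] (A : Matrix ι ι ℝ) : ℝ :=
  Real.sqrt (∑ i, ∑ j, A i j ^ 2)

theorem boolCube_finite (d : ℕ) : (boolCube d).Finite := by
  have h : (Set.pi Set.univ (fun _ : Fin d => ({1, -1} : Set ℝ))).Finite :=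
    Set.Finite.pi' (fun _ => Set.toFinite _) |>.subset (fun x hx i => hx i (Set.mem_univ i))
  exact h.subset (fun x hx i _ => by simpa using hx i)

theorem boolSlice_finite (d : ℕ) (μ : ℝ) : (boolSlice d μ).Finite :=
  (boolCube_finite d).subset (fun _ hx => hx.1)

theorem boolCube_nonempty (d : ℕ) : (boolCube d).Nonempty :=
  ⟨fun _ => 1, fun _ => Or.inl rfl⟩

theorem measurable_concatBlocks {d₁ d₂ d₃ : ℕ} :
    Measurable (concatBlocks : (Fin d₁ → ℝ) × (Fin d₂ → ℝ) × (Fin d₃ → ℝ) → _) := by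
  refine measurable_pi_lambda _ ?_
  rintro (i | i | i) <;> simp only [concatBlocks, Sum.elim_inl, Sum.elim_inr] <;> fun_prop

/-- `cubeSliceLaw` is a probability measure as soon as the two slices are nonempty. -/
theorem isProbabilityMeasure_cubeSliceLaw (d₁ d₂ d₃ : ℕ) (μ ν : ℝ)
    (h₂ : (boolSlice d₂ μ).Nonempty) (h₃ : (boolSlice d₃ ν).Nonempty) :
    IsProbabilityMeasure (cubeSliceLaw d₁ d₂ d₃ μ ν) := by
  have i₁ := isProbabilityMeasure_uniformOn (boolCube_finite d₁) (boolCube_nonempty d₁)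
  have i₂ := isProbabilityMeasure_uniformOn (boolSlice_finite d₂ μ) h₂
  have i₃ := isProbabilityMeasure_uniformOn (boolSlice_finite d₃ ν) h₃
  exact Measure.isProbabilityMeasure_map measurable_concatBlocks.aemeasurable

/-!
Both bounds come from estimates of moment generating functions under the uniform distribution on a
finite set `Ω` of sign vectors, the support of `cubeSliceLaw`.

*Linear forms.* For a vector `x` with entries in `[-1, 1]` and a uniform permutation `σ`, revealing
`σ` one coordinate at a time and applying Hoeffding's lemma at each step bounds the moment
generating function of `∑ i, b i * x (σ i)` by that of a subgaussian variable with variance proxy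
`2 * ∑ i, b i ^ 2` (`sum_perm_exp_le`). The induction closes because, after `b` is centred, the
potential `∑ i, (b i - b̄) ^ 2` drops at each step by at least the cost of that step. A slice
is a single orbit of the symmetric group, so its linear forms are subgaussian around the mean;
for the cube this is `cosh s ≤ exp (s ^ 2 / 2)`.

*Quadratic forms.* Since `x i ^ 2 = 1`, the diagonal of `A` contributes the constant `trace A`, and
by convexity the rest may be replaced by the decoupled forms `4 * ⟨x, cutMatrix A I x⟩`, in which
rows are taken in `I` and columns outside `I` (`exp_quadratic_le_sum_cutMatrix`). Given the
coordinates outside `I`, the law is invariant under permutations of the rest of each block.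
Averaging over these permutations (`sum_exp_block_le`) leaves the exponential of
`λ² ‖cutMatrix A I x‖²` plus a cross term with the block sums of `x` over `I`, which by AM-GM costs only the squares of the normalized block sums. Nothing has to be known about the conditional
means: the normalized block sums are linear forms with unit coefficient vectors, hence
subgaussian themselves. What is left are exponential moments of sums of squares `⟨b k, x⟩²` with
orthogonal `b k`; they are linearized by a Gaussian vector and reduce to one-dimensional Gaussian
integrals (`HasSubgaussianForms.sum_exp_sum_sq_le`). For `‖cutMatrix A I x‖²` the `b k` are
eigenvectors. The mean vector `m` enters these moments through `⟨b k, m⟩²`, which is controlled by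
`‖m‖²`; the assumptions on `|μ| √d₂` and `|ν| √d₃` serve to give `‖m‖² ≤ 2 c²`.

The outcome, `sum_exp_quadratic_le`, is centred at `trace A`. Jensen's inequality with the opposite
parameter bounds the distance from the trace to the expectation, and Chernoff's bound concludes.
-/

open scoped Finset

/-! ### Averages over permutations -/

/-- Hoeffding's lemma for the uniform distribution on finitely many points of `[-1, 1]`. -/
theorem sum_exp_mul_le_card_mul_exp {α : Type*} [Fintype α] (x : α → ℝ)
    (hx : ∀ a, |x a| ≤ 1) (β : ℝ) :
    ∑ a, Real.exp (β * x a) ≤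
      Fintype.card α * Real.exp (β * ((∑ a, x a) / Fintype.card α) + β ^ 2 / 2) := by
  classical
  rcases isEmpty_or_nonempty α with h | h
  · simp
  have hN : (0 : ℝ) < Fintype.card α := by exact_mod_cast Fintype.card_pos
  set N : ℝ := (Fintype.card α : ℝ) with hNdef
  let _ : MeasurableSpace α := ⊤
  set P : Measure α := uniformOn Set.univ with hP
  have : IsProbabilityMeasure P := isProbabilityMeasure_uniformOn Set.finite_univ Set.univ_nonempty
  have hint : ∀ f : α → ℝ, ∫ a, f a ∂P = (∑ a, f a) / N := by
    intro f
    rw [integral_fintype (Integrable.of_finite)]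
    simp only [measureReal_def, hP, uniformOn_univ, smul_eq_mul, Measure.count_singleton,
      ENNReal.toReal_div, ENNReal.toReal_one, ENNReal.toReal_natCast]
    rw [Finset.sum_div]
    exact Finset.sum_congr rfl fun a _ => by rw [← hNdef]; ring
  have key := (hasSubgaussianMGF_of_mem_Icc (μ := P) (X := x) (a := -1) (b := 1)
    (measurable_of_finite x).aemeasurable
    (Filter.Eventually.of_forall fun a => abs_le.mp (hx a))).mgf_le β
  rw [mgf, hint, hint] at key
  have e1 : ((((‖(1 : ℝ) - -1‖₊ / 2) ^ 2 : NNReal)) : ℝ) = 1 := by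
    norm_num
  rw [e1, one_mul, div_le_iff₀ hN] at key
  calc ∑ a, Real.exp (β * x a)
      = Real.exp (β * ((∑ a, x a) / N)) * ∑ a, Real.exp (β * (x a - (∑ a, x a) / N)) := by
        rw [Finset.mul_sum]
        refine Finset.sum_congr rfl fun a _ => ?_
        rw [← Real.exp_add]; congr 1; ring
    _ ≤ Real.exp (β * ((∑ a, x a) / N)) * (Real.exp (β ^ 2 / 2) * N) := by gcongr
    _ = _ := by rw [Real.exp_add]; ring

/-- The sum over `σ` splits according to `p = σ 0`; the induction hypothesis, applied to the
remaining entries of `x`, gives an exponent that is affine in `x p`, with slope `b 0` minus the mean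
of the other coefficients. The variance term `- (∑ i, b i) ^ 2 / n` is what makes the induction
close. -/
theorem sum_perm_exp_fin_le (n : ℕ) (b x : Fin n → ℝ) (hx : ∀ i, |x i| ≤ 1) :
    ∑ σ : Equiv.Perm (Fin n), Real.exp (∑ i, b i * x (σ i)) ≤
      n.factorial * Real.exp ((∑ i, b i) * (∑ i, x i) / n + ∑ i, b i ^ 2
        - (∑ i, b i) ^ 2 / n) := by
  induction n with
  | zero => simp
  | succ n ih =>
    rcases Nat.eq_zero_or_pos n with rfl | hn
    · simp
    have hn' : (1 : ℝ) ≤ n := by exact_mod_cast hn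
    have hn0 : (n : ℝ) ≠ 0 := by positivity
    set B := ∑ i : Fin n, b i.succ with hB
    set V := ∑ i : Fin n, b i.succ ^ 2 with hV
    set X := ∑ i, x i with hX
    rw [← Equiv.sum_comp Equiv.Perm.decomposeFin.symm, Fintype.sum_prod_type]
    have hsum : ∀ p : Fin (n + 1), ∑ j : Fin n, x (Equiv.swap 0 p j.succ) = X - x p := by
      intro p
      have := Equiv.sum_comp (Equiv.swap 0 p) x
      rw [Fin.sum_univ_succ, Equiv.swap_apply_left] at this
      linarith
    have h1 : ∀ p : Fin (n + 1), ∑ e : Equiv.Perm (Fin n),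
        Real.exp (∑ i, b i * x (Equiv.Perm.decomposeFin.symm (p, e) i)) ≤
        (n.factorial * Real.exp (B * X / n + V - B ^ 2 / n)) *
          Real.exp ((b 0 - B / n) * x p) := by
      intro p
      have := ih (fun i => b i.succ) (fun j => x (Equiv.swap 0 p j.succ)) fun _ => hx _
      rw [hsum] at this
      calc _ = Real.exp (b 0 * x p) * ∑ e : Equiv.Perm (Fin n),
              Real.exp (∑ i, b i.succ * x (Equiv.swap 0 p (e i).succ)) := by
            rw [Finset.mul_sum]
            refine Finset.sum_congr rfl fun e _ => ?_
            rw [← Real.exp_add, Fin.sum_univ_succ]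
            simp only [Equiv.Perm.decomposeFin_symm_apply_zero,
              Equiv.Perm.decomposeFin_symm_apply_succ]
        _ ≤ Real.exp (b 0 * x p) * (n.factorial *
              Real.exp (B * (X - x p) / n + V - B ^ 2 / n)) := by gcongr
        _ = _ := by
            rw [mul_left_comm, mul_assoc, ← Real.exp_add, ← Real.exp_add]
            congr 2; ring
    refine (Finset.sum_le_sum fun p _ => h1 p).trans ?_
    rw [← Finset.mul_sum]
    have h2 := sum_exp_mul_le_card_mul_exp x hx (b 0 - B / n)
    rw [Fintype.card_fin, ← hX] at h2
    refine (mul_le_mul_of_nonneg_left h2 (by positivity)).trans ?_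
    rw [mul_mul_mul_comm, ← Real.exp_add, Fin.sum_univ_succ, Fin.sum_univ_succ, ← hB, ← hV,
      Nat.factorial_succ]
    push_cast
    rw [mul_comm (n.factorial : ℝ)]
    refine mul_le_mul_of_nonneg_left (Real.exp_le_exp.2 ?_) (by positivity)
    -- The two exponents differ by `(n / (n + 1) - 1 / 2) * (b 0 - B / n) ^ 2`.
    have : (b 0 + B) * X / (n + 1) + (b 0 ^ 2 + V) - (b 0 + B) ^ 2 / (n + 1)
        - (B * X / n + V - B ^ 2 / n + ((b 0 - B / n) * (X / (n + 1)) + (b 0 - B / n) ^ 2 / 2))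
        = ((n - 1) / (2 * (n + 1))) * (b 0 - B / n) ^ 2 := by
      field_simp; ring
    have h3 : 0 ≤ ((n - 1 : ℝ) / (2 * (n + 1))) * (b 0 - B / n) ^ 2 :=
      mul_nonneg (div_nonneg (by linarith) (by positivity)) (sq_nonneg _)
    linarith

theorem sum_perm_exp_le {α : Type*} [Fintype α] [DecidableEq α] (b x : α → ℝ)
    (hx : ∀ i, |x i| ≤ 1) :
    ∑ σ : Equiv.Perm α, Real.exp (∑ i, b i * x (σ i)) ≤
      Fintype.card (Equiv.Perm α) *
        Real.exp ((∑ i, b i) * (∑ i, x i) / Fintype.card α + ∑ i, b i ^ 2) := by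
  set e := Fintype.equivFin α
  have h := sum_perm_exp_fin_le _ (b ∘ e.symm) (x ∘ e.symm) fun _ => hx _
  rw [← Equiv.sum_comp e.permCongr] at h
  have h0 : ∀ f : α → ℝ, ∑ i, f (e.symm i) = ∑ i, f i := fun f => Equiv.sum_comp e.symm f
  have h1 : ∀ σ : Equiv.Perm α, ∑ i, (b ∘ e.symm) i * (x ∘ e.symm) (e.permCongr σ i)
      = ∑ i, b i * x (σ i) := fun σ => by
    simp only [Function.comp, Equiv.permCongr_apply, Equiv.symm_apply_apply]
    exact h0 fun i => b i * x (σ i)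
  simp only [h1] at h
  simp only [Function.comp, h0] at h
  rw [h0 (fun i => b i ^ 2)] at h
  rw [Fintype.card_perm]
  refine h.trans ?_
  gcongr
  linarith [show 0 ≤ (∑ i, b i) ^ 2 / (Fintype.card α : ℝ) by positivity]

/-- If `Ω` is invariant under the permutations of the coordinates in `T`, then a linear form in
these coordinates whose coefficients, like the remaining term `h`, are invariant under them may be
averaged over the permutations. For coefficients that ignore the coordinates in `T` this is a
conditional subgaussian estimate, with the empirical mean over `T` as the centre. -/
theorem sum_exp_block_le {ι : Type*} [Fintype ι] [DecidableEq ι] (Ω : Finset (ι → ℝ))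
    (T : Finset ι) (hΩ : ∀ x ∈ Ω, ∀ i, |x i| ≤ 1)
    (hinv : ∀ σ : Equiv.Perm ι, (∀ i ∉ T, σ i = i) → ∀ x ∈ Ω, x ∘ σ ∈ Ω)
    (b : (ι → ℝ) → ι → ℝ) (h : (ι → ℝ) → ℝ)
    (hb : ∀ σ : Equiv.Perm ι, (∀ i ∉ T, σ i = i) → ∀ x, b (x ∘ σ) = b x)
    (hh : ∀ σ : Equiv.Perm ι, (∀ i ∉ T, σ i = i) → ∀ x, h (x ∘ σ) = h x) :
    ∑ x ∈ Ω, Real.exp (∑ i ∈ T, b x i * x i + h x) ≤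
      ∑ x ∈ Ω, Real.exp ((∑ i ∈ T, b x i) * (∑ i ∈ T, x i) / T.card + ∑ i ∈ T, b x i ^ 2
        + h x) := by
  have hfix : ∀ τ : Equiv.Perm T, ∀ i ∉ T, Equiv.Perm.ofSubtype τ i = i :=
    fun τ i hi => Equiv.Perm.ofSubtype_apply_of_not_mem τ hi
  have hcoe : ∀ (τ : Equiv.Perm T) (i : T), Equiv.Perm.ofSubtype τ (i : ι) = τ i :=
    fun τ i => Equiv.Perm.ofSubtype_apply_coe τ i
  have hreindex : ∀ (τ : Equiv.Perm T) (F : (ι → ℝ) → ℝ),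
      ∑ x ∈ Ω, F (x ∘ Equiv.Perm.ofSubtype τ) = ∑ x ∈ Ω, F x := by
    intro τ F
    refine Finset.sum_bij' (fun x _ => x ∘ Equiv.Perm.ofSubtype τ)
      (fun x _ => x ∘ Equiv.Perm.ofSubtype τ⁻¹) (fun x hx => hinv _ (hfix _) x hx)
      (fun x hx => hinv _ (hfix _) x hx) ?_ ?_ ?_
    · intro x _; ext i; simp
    · intro x _; ext i; simp
    · intro x _; rfl
  have hN : (0 : ℝ) < Fintype.card (Equiv.Perm T) := by exact_mod_cast Fintype.card_pos
  refine le_of_mul_le_mul_left ?_ hN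
  calc (Fintype.card (Equiv.Perm T) : ℝ) * ∑ x ∈ Ω, Real.exp (∑ i ∈ T, b x i * x i + h x)
      = ∑ τ : Equiv.Perm T, ∑ x ∈ Ω, Real.exp (∑ i : T, b x i * x (τ i) + h x) := by
        rw [← nsmul_eq_mul, ← Finset.card_univ, ← Finset.sum_const]
        refine Finset.sum_congr rfl fun τ _ => ?_
        rw [← hreindex τ]
        refine Finset.sum_congr rfl fun x _ => ?_
        rw [hb _ (hfix τ), hh _ (hfix τ), ← Finset.sum_coe_sort]
        simp only [Function.comp, hcoe]
    _ = ∑ x ∈ Ω, Real.exp (h x) * ∑ τ : Equiv.Perm T, Real.exp (∑ i : T, b x i * x (τ i)) := by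
        rw [Finset.sum_comm]
        refine Finset.sum_congr rfl fun x _ => ?_
        rw [Finset.mul_sum]
        exact Finset.sum_congr rfl fun τ _ => by rw [Real.exp_add, mul_comm]
    _ ≤ ∑ x ∈ Ω, Real.exp (h x) * (Fintype.card (Equiv.Perm T) *
          Real.exp ((∑ i : T, b x i) * (∑ i : T, x i) / Fintype.card T
            + ∑ i : T, b x i ^ 2)) := by
        refine Finset.sum_le_sum fun x hx => mul_le_mul_of_nonneg_left ?_ (Real.exp_nonneg _)
        exact sum_perm_exp_le (fun i : T => b x i) (fun i : T => x i) fun i => hΩ x hx i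
    _ = _ := by
        rw [Finset.mul_sum]
        refine Finset.sum_congr rfl fun x _ => ?_
        rw [Finset.sum_coe_sort T (b x), Finset.sum_coe_sort T x,
          Finset.sum_coe_sort T (fun i => b x i ^ 2), Fintype.card_coe, Real.exp_add _ (h x)]
        ring

/-! ### Gaussian integrals -/

theorem integral_exp_quadratic_gaussianReal_eq {a b : ℝ} (hb : b < 1 / 2) :
    ∫ g, Real.exp (a * g + b * g ^ 2) ∂(gaussianReal 0 1) =
      √(1 / (1 - 2 * b)) * Real.exp (a ^ 2 / (2 * (1 - 2 * b))) := by
  have hpos : 0 < 1 - 2 * b := by linarith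
  set v : NNReal := ⟨1 / (1 - 2 * b), by positivity⟩ with hv
  have hvr : (v : ℝ) = 1 / (1 - 2 * b) := rfl
  have hv0 : v ≠ 0 := by
    rw [← NNReal.coe_ne_zero, hvr]; positivity
  have h1 : ∀ g : ℝ, gaussianPDFReal 0 1 g • Real.exp (a * g + b * g ^ 2) =
      √(1 / (1 - 2 * b)) * (gaussianPDFReal 0 v g • Real.exp (a * g)) := by
    intro g
    simp only [gaussianPDFReal, hvr, smul_eq_mul, NNReal.coe_one, mul_one, sub_zero]
    have h2 : √(1 / (1 - 2 * b)) * (√(2 * Real.pi * (1 / (1 - 2 * b))))⁻¹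
        = (√(2 * Real.pi))⁻¹ := by
      rw [Real.sqrt_mul (by positivity) (1 / (1 - 2 * b)), mul_inv, mul_left_comm,
        mul_inv_cancel₀ (by positivity), mul_one]
    have h3 : Real.exp (-g ^ 2 / 2) * Real.exp (a * g + b * g ^ 2) =
        Real.exp (-g ^ 2 / (2 * (1 / (1 - 2 * b)))) * Real.exp (a * g) := by
      rw [← Real.exp_add, ← Real.exp_add]
      congr 1
      field_simp
      ring
    rw [← h2, mul_assoc, h3]
    ring
  rw [integral_gaussianReal_eq_integral_smul one_ne_zero]
  simp only [h1]
  rw [integral_const_mul, ← integral_gaussianReal_eq_integral_smul hv0]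
  have h3 := congrFun (mgf_fun_id_gaussianReal (μ := 0) (v := v)) a
  rw [mgf] at h3
  rw [h3, hvr]
  congr 2
  field_simp
  ring

theorem integrable_exp_quadratic_gaussianReal {a b : ℝ} (hb : b < 1 / 2) :
    Integrable (fun g => Real.exp (a * g + b * g ^ 2)) (gaussianReal 0 1) := by
  -- The integral is nonzero, whereas the Bochner integral of a non-integrable function is `0`.
  by_contra h
  have h1 := integral_exp_quadratic_gaussianReal_eq (a := a) hb
  have hpos : 0 < 1 - 2 * b := by linarith
  rw [integral_undef h] at h1
  have : 0 < √(1 / (1 - 2 * b)) * Real.exp (a ^ 2 / (2 * (1 - 2 * b))) := by positivity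
  linarith

theorem integral_exp_quadratic_gaussianReal_le {a b : ℝ} (hb0 : 0 ≤ b) (hb : b ≤ 1 / 4) :
    ∫ g, Real.exp (a * g + b * g ^ 2) ∂(gaussianReal 0 1) ≤ Real.exp (2 * b + a ^ 2) := by
  rw [integral_exp_quadratic_gaussianReal_eq (by linarith), Real.exp_add]
  have hpos : 0 < 1 - 2 * b := by linarith
  gcongr
  · rw [Real.sqrt_le_left (by positivity), ← Real.exp_nat_mul, div_le_iff₀ hpos]
    have h1 := Real.add_one_le_exp ((2 : ℕ) * (2 * b))
    push_cast at h1 ⊢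
    nlinarith
  · rw [div_le_iff₀ (by positivity)]
    nlinarith [sq_nonneg a]

/-! ### Subgaussian linear forms and sums of squares -/

/-- The uniform distribution on `Ω` has subgaussian linear forms, centred at those of `m`: the
moment generating function of `⟨v, x - m⟩` is at most `exp ‖v‖²`. The inequality is cleared of
the denominator `|Ω|`. -/
def HasSubgaussianForms {ι : Type*} [Fintype ι] (Ω : Finset (ι → ℝ)) (m : ι → ℝ) : Prop :=
  ∀ v : ι → ℝ, ∑ x ∈ Ω, Real.exp (v ⬝ᵥ x) ≤ Ω.card * Real.exp (v ⬝ᵥ m + v ⬝ᵥ v)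

/-- Exponential moments of a sum of squares of orthogonal linear forms. With `g` standard Gaussian,
`exp (∑ k, ⟨b k, x⟩ ^ 2)` is the expectation over `g` of the exponential of the linear form
`∑ k, √2 * g k * ⟨b k, x⟩`. Averaging over `x` first leaves, by orthogonality, a product of
one-dimensional Gaussian integrals. -/
theorem HasSubgaussianForms.sum_exp_sum_sq_le {ι κ : Type*} [Fintype ι] [Fintype κ]
    {Ω : Finset (ι → ℝ)} {m : ι → ℝ} (hΩ : HasSubgaussianForms Ω m) (b : κ → ι → ℝ)
    (horth : Pairwise fun k l => b k ⬝ᵥ b l = 0) (hb : ∀ k, b k ⬝ᵥ b k ≤ 1 / 8) :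
    ∑ x ∈ Ω, Real.exp (∑ k, (b k ⬝ᵥ x) ^ 2) ≤
      Ω.card * Real.exp (∑ k, (4 * (b k ⬝ᵥ b k) + 2 * (b k ⬝ᵥ m) ^ 2)) := by
  classical
  have hb0 : ∀ k, 0 ≤ b k ⬝ᵥ b k := fun k =>
    Finset.sum_nonneg fun i _ => mul_self_nonneg _
  set G : Measure (κ → ℝ) := Measure.pi fun _ => gaussianReal 0 1 with hG
  -- For Gaussian `g` the vector `∑ k, √2 g k • b k` linearizes the squares.
  set W : (κ → ℝ) → ι → ℝ := fun g => ∑ k, (√2 * g k) • b k with hW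
  have hWdot : ∀ (g : κ → ℝ) (y : ι → ℝ), W g ⬝ᵥ y = ∑ k, (√2 * (b k ⬝ᵥ y)) * g k := by
    intro g y
    simp only [hW, sum_dotProduct, smul_dotProduct, smul_eq_mul]
    exact Finset.sum_congr rfl fun k _ => by ring
  have hWself : ∀ g : κ → ℝ, W g ⬝ᵥ W g = ∑ k, (2 * (b k ⬝ᵥ b k)) * g k ^ 2 := by
    intro g
    rw [hWdot]
    refine Finset.sum_congr rfl fun k _ => ?_
    have : b k ⬝ᵥ W g = √2 * g k * (b k ⬝ᵥ b k) := by
      simp only [hW, dotProduct_sum, dotProduct_smul, smul_eq_mul]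
      rw [Finset.sum_eq_single k (fun l _ hl => by rw [horth hl.symm, mul_zero])
        (fun h => absurd (Finset.mem_univ k) h)]
    rw [this]
    linear_combination (b k ⬝ᵥ b k) * g k ^ 2 * Real.mul_self_sqrt (zero_le_two : (0:ℝ) ≤ 2)
  have hexp : ∀ a c : κ → ℝ, ∀ g : κ → ℝ,
      Real.exp (∑ k, a k * g k + ∑ k, c k * g k ^ 2) =
        ∏ k, Real.exp (a k * g k + c k * g k ^ 2) := by
    intro a c g
    rw [← Real.exp_sum, Finset.sum_add_distrib]
  have hint : ∀ a c : κ → ℝ, (∀ k, c k ≤ 1 / 4) →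
      Integrable (fun g : κ → ℝ => Real.exp (∑ k, a k * g k + ∑ k, c k * g k ^ 2)) G := by
    intro a c hc
    simp only [hexp]
    exact Integrable.fintype_prod (f := fun k t => Real.exp (a k * t + c k * t ^ 2))
      fun k => integrable_exp_quadratic_gaussianReal (by linarith [hc k])
  have hintW : ∀ x, Integrable (fun g : κ → ℝ => Real.exp (W g ⬝ᵥ x)) G := by
    intro x
    have := hint (fun k => √2 * (b k ⬝ᵥ x)) 0 (fun _ => by norm_num)
    simpa [hWdot] using this
  have hlin : ∀ x, Real.exp (∑ k, (b k ⬝ᵥ x) ^ 2) = ∫ g, Real.exp (W g ⬝ᵥ x) ∂G := by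
    intro x
    have h1 : ∀ g : κ → ℝ, Real.exp (W g ⬝ᵥ x) =
        ∏ k, Real.exp ((√2 * (b k ⬝ᵥ x)) * g k) := fun g => by
      rw [hWdot, Real.exp_sum]
    simp only [h1]
    rw [hG, integral_fintype_prod_eq_prod (fun k t => Real.exp ((√2 * (b k ⬝ᵥ x)) * t)),
      Real.exp_sum]
    refine Finset.prod_congr rfl fun k _ => ?_
    have h3 := congrFun (mgf_fun_id_gaussianReal (μ := 0) (v := 1)) (√2 * (b k ⬝ᵥ x))
    rw [mgf] at h3
    rw [h3, mul_pow, Real.sq_sqrt zero_le_two]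
    congr 1
    push_cast
    ring
  calc ∑ x ∈ Ω, Real.exp (∑ k, (b k ⬝ᵥ x) ^ 2)
      = ∫ g, ∑ x ∈ Ω, Real.exp (W g ⬝ᵥ x) ∂G := by
        rw [integral_finsetSum _ fun x _ => hintW x]
        exact Finset.sum_congr rfl fun x _ => hlin x
    _ ≤ ∫ g, Ω.card * Real.exp (∑ k, (√2 * (b k ⬝ᵥ m)) * g k
          + ∑ k, (2 * (b k ⬝ᵥ b k)) * g k ^ 2) ∂G := by
        refine integral_mono (integrable_finsetSum _ fun x _ => hintW x)
          ((hint _ _ fun k => by linarith [hb k]).const_mul _) fun g => ?_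
        have := hΩ (W g)
        rwa [hWself, hWdot g m] at this
    _ ≤ _ := by
        rw [integral_const_mul]
        refine mul_le_mul_of_nonneg_left ?_ (Nat.cast_nonneg _)
        simp only [hexp]
        rw [hG, integral_fintype_prod_eq_prod
          (fun k t => Real.exp ((√2 * (b k ⬝ᵥ m)) * t + (2 * (b k ⬝ᵥ b k)) * t ^ 2)),
          Real.exp_sum]
        refine Finset.prod_le_prod (fun k _ => integral_nonneg fun t => Real.exp_nonneg _)
          fun k _ => ?_
        refine (integral_exp_quadratic_gaussianReal_le (by linarith [hb0 k])
          (by linarith [hb k])).trans (Real.exp_le_exp.2 (le_of_eq ?_))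
        rw [mul_pow, Real.sq_sqrt zero_le_two]
        ring

/-- The case of `θ * ‖B x‖²`: the orthogonal vectors are the eigenvectors of `Bᵀ * B`, scaled by
the square roots of `θ` times the eigenvalues. -/
theorem HasSubgaussianForms.sum_exp_sq_norm_mulVec_le {ι : Type*} [Fintype ι] [DecidableEq ι]
    {Ω : Finset (ι → ℝ)} {m : ι → ℝ} (hΩ : HasSubgaussianForms Ω m) (B : Matrix ι ι ℝ)
    {N θ : ℝ} (hN : ∀ x, B *ᵥ x ⬝ᵥ B *ᵥ x ≤ N ^ 2 * (x ⬝ᵥ x)) (hθ : 0 ≤ θ)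
    (hθN : θ * N ^ 2 ≤ 1 / 8) :
    ∑ x ∈ Ω, Real.exp (θ * (B *ᵥ x ⬝ᵥ B *ᵥ x)) ≤
      Ω.card * Real.exp (4 * θ * ∑ i, ∑ j, B i j ^ 2 + 2 * θ * (B *ᵥ m ⬝ᵥ B *ᵥ m)) := by
  have hH : (Bᵀ * B).IsHermitian := by
    simpa using Matrix.isHermitian_conjTranspose_mul_self B
  set e : ι → ι → ℝ := fun k => ⇑(hH.eigenvectorBasis k) with he
  set ev := hH.eigenvalues with hev
  have hBB : ∀ x y : ι → ℝ, B *ᵥ x ⬝ᵥ B *ᵥ y = x ⬝ᵥ (Bᵀ * B) *ᵥ y := by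
    intro x y
    rw [← Matrix.mulVec_mulVec, Matrix.dotProduct_mulVec x, Matrix.vecMul_transpose]
  have heig : ∀ k, (Bᵀ * B) *ᵥ e k = ev k • e k := fun k => hH.mulVec_eigenvectorBasis k
  have hee : ∀ k l, e k ⬝ᵥ e l = if k = l then 1 else 0 := by
    intro k l
    have h := orthonormal_iff_ite.1 hH.eigenvectorBasis.orthonormal k l
    rw [EuclideanSpace.inner_eq_star_dotProduct] at h
    rw [← h, dotProduct_comm]
    simp [he]
  have hexpand : ∀ x : ι → ℝ, x = ∑ k, (e k ⬝ᵥ x) • e k := by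
    intro x
    have h := hH.eigenvectorBasis.sum_repr' (WithLp.toLp 2 x)
    have h2 := congrArg WithLp.ofLp h
    rw [WithLp.ofLp_sum] at h2
    conv_lhs => rw [← WithLp.ofLp_toLp 2 x, ← h2]
    refine Finset.sum_congr rfl fun k _ => ?_
    rw [WithLp.ofLp_smul, EuclideanSpace.inner_eq_star_dotProduct]
    simp [he, dotProduct_comm]
  have hquad : ∀ x : ι → ℝ, B *ᵥ x ⬝ᵥ B *ᵥ x = ∑ k, ev k * (e k ⬝ᵥ x) ^ 2 := by
    intro x
    rw [hBB]
    conv_lhs => rw [hexpand x]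
    rw [Matrix.mulVec_sum, ← hexpand x, dotProduct_sum]
    refine Finset.sum_congr rfl fun k _ => ?_
    rw [Matrix.mulVec_smul, heig, dotProduct_smul, dotProduct_smul, smul_eq_mul, smul_eq_mul,
      dotProduct_comm x]
    ring
  have hevB : ∀ k, ev k = B *ᵥ e k ⬝ᵥ B *ᵥ e k := fun k => by
    rw [hBB, heig, dotProduct_smul, hee]; simp
  have hev0 : ∀ k, 0 ≤ ev k := fun k => by
    rw [hevB]; exact Finset.sum_nonneg fun i _ => mul_self_nonneg _
  have hevN : ∀ k, ev k ≤ N ^ 2 := fun k => by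
    have := hN (e k)
    rwa [← hevB, hee, if_pos rfl, mul_one] at this
  have htrace : ∑ k, ev k = ∑ i, ∑ j, B i j ^ 2 := by
    have h := hH.trace_eq_sum_eigenvalues
    simp only [RCLike.ofReal_real_eq_id, id] at h
    rw [← hev] at h
    rw [← h, Finset.sum_comm, Matrix.trace]
    refine Finset.sum_congr rfl fun j _ => ?_
    rw [Matrix.diag_apply, Matrix.mul_apply]
    exact Finset.sum_congr rfl fun i _ => by rw [Matrix.transpose_apply, sq]
  set b : ι → ι → ℝ := fun k => √(θ * ev k) • e k with hbdef
  have hbsq : ∀ k (x : ι → ℝ), (b k ⬝ᵥ x) ^ 2 = θ * ev k * (e k ⬝ᵥ x) ^ 2 := fun k x => by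
    rw [hbdef, smul_dotProduct, smul_eq_mul, mul_pow, Real.sq_sqrt (mul_nonneg hθ (hev0 k))]
  have hbb : ∀ k l, b k ⬝ᵥ b l = √(θ * ev k) * (√(θ * ev l) * if k = l then 1 else 0) :=
    fun k l => by rw [hbdef, smul_dotProduct, dotProduct_smul, hee, smul_eq_mul, smul_eq_mul]
  have hbself : ∀ k, b k ⬝ᵥ b k = θ * ev k := fun k => by
    rw [hbb, if_pos rfl, mul_one, Real.mul_self_sqrt (mul_nonneg hθ (hev0 k))]
  have hsum : ∀ x : ι → ℝ, ∑ k, (b k ⬝ᵥ x) ^ 2 = θ * (B *ᵥ x ⬝ᵥ B *ᵥ x) := fun x => by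
    rw [hquad, Finset.mul_sum]
    exact Finset.sum_congr rfl fun k _ => by rw [hbsq]; ring
  have key := hΩ.sum_exp_sum_sq_le b (fun k l hkl => (hbb k l).trans (by rw [if_neg hkl]; simp))
    (fun k => by
      rw [hbself]
      exact (mul_le_mul_of_nonneg_left (hevN k) hθ).trans hθN)
  simp only [hsum] at key
  refine key.trans (le_of_eq ?_)
  rw [Finset.sum_add_distrib, ← Finset.mul_sum, ← Finset.mul_sum, hsum]
  simp only [hbself]
  rw [← Finset.mul_sum, htrace]
  congr 2
  ring

/-! ### Decoupling of quadratic forms -/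

/-- `Ω` is invariant under the permutations of the coordinates that preserve each fibre of `κ`. -/
def BlockInvariant {ι L : Type*} (κ : ι → L) (Ω : Finset (ι → ℝ)) : Prop :=
  ∀ σ : Equiv.Perm ι, (∀ i, κ (σ i) = κ i) → ∀ x ∈ Ω, x ∘ σ ∈ Ω

theorem mulVec_sq_le_sum_sq_mul {ι : Type*} [Fintype ι] (B : Matrix ι ι ℝ) (x : ι → ℝ) :
    B *ᵥ x ⬝ᵥ B *ᵥ x ≤ (∑ i, ∑ j, B i j ^ 2) * (x ⬝ᵥ x) := by
  rw [Finset.sum_mul]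
  refine Finset.sum_le_sum fun i _ => ?_
  have h := Finset.sum_mul_sq_le_sq_mul_sq Finset.univ (fun j => B i j) x
  simp only [dotProduct, Matrix.mulVec, ← sq]
  exact h


section Decoupling

variable {ι L : Type*} [Fintype ι] [DecidableEq ι] [Fintype L] [DecidableEq L]

/-- Averaging over the permutations of `I ∩ κ⁻¹ k` for each `k ∈ S`, when the coefficients `b x`
depend only on the coordinates of `x` outside `I`. The cross term of `sum_exp_block_le` is split by
AM-GM; the weight `1 / 16` leaves squares whose exponential moments are controlled by
`HasSubgaussianForms.sum_exp_sum_sq_le`. -/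
theorem BlockInvariant.sum_exp_sum_blocks_le {κ : ι → L} {Ω : Finset (ι → ℝ)}
    (hinv : BlockInvariant κ Ω) (hΩ : ∀ x ∈ Ω, ∀ i, |x i| ≤ 1) (I : Finset ι)
    (b : (ι → ℝ) → ι → ℝ) (hb : ∀ x y : ι → ℝ, (∀ i ∉ I, x i = y i) → b x = b y)
    (S : Finset L) :
    ∑ x ∈ Ω, Real.exp (∑ k, ∑ i ∈ I with κ i = k, b x i * x i) ≤
      ∑ x ∈ Ω, Real.exp (∑ k ∈ S, ((∑ i ∈ I with κ i = k, x i) ^ 2 / (16 * #{i ∈ I | κ i = k})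
          + 5 * ∑ i ∈ I with κ i = k, b x i ^ 2)
        + ∑ k ∈ Sᶜ, ∑ i ∈ I with κ i = k, b x i * x i) := by
  induction S using Finset.induction_on with
  | empty => simp
  | insert k₀ S hk₀ ih =>
    refine ih.trans ?_
    set T : Finset ι := {i ∈ I | κ i = k₀} with hT
    have hcompl : Sᶜ = insert k₀ (insert k₀ S)ᶜ := by
      ext k
      by_cases h : k = k₀ <;> simp [h, hk₀]
    set h : (ι → ℝ) → ℝ := fun x =>
      ∑ k ∈ S, ((∑ i ∈ I with κ i = k, x i) ^ 2 / (16 * #{i ∈ I | κ i = k})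
          + 5 * ∑ i ∈ I with κ i = k, b x i ^ 2)
        + ∑ k ∈ (insert k₀ S)ᶜ, ∑ i ∈ I with κ i = k, b x i * x i with hh
    have hbσ : ∀ σ : Equiv.Perm ι, (∀ i ∉ T, σ i = i) → ∀ x, b (x ∘ σ) = b x := by
      intro σ hσ x
      refine hb _ _ fun i hi => ?_
      rw [Function.comp, hσ i fun hiT => hi (Finset.mem_filter.1 hiT).1]
    have hσk : ∀ σ : Equiv.Perm ι, (∀ i ∉ T, σ i = i) → ∀ k ≠ k₀, ∀ i ∈ I.filter (κ · = k),
        σ i = i := by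
      intro σ hσ k hk i hi
      refine hσ i fun hiT => hk ?_
      rw [← (Finset.mem_filter.1 hi).2, (Finset.mem_filter.1 hiT).2]
    have key := sum_exp_block_le Ω T hΩ (fun σ hσ => hinv σ fun i => ?_) b h hbσ
      (fun σ hσ x => ?_)
    · calc _ = ∑ x ∈ Ω, Real.exp (∑ i ∈ T, b x i * x i + h x) := by
            refine Finset.sum_congr rfl fun x _ => ?_
            rw [hcompl, Finset.sum_insert (by simp)]
            congr 1
            simp only [hh]
            ring
        _ ≤ _ := key
        _ ≤ _ := by
            refine Finset.sum_le_sum fun x _ => Real.exp_le_exp.2 ?_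
            rw [Finset.sum_insert hk₀]
            have h1 : (∑ i ∈ T, b x i) * (∑ i ∈ T, x i) / (T.card : ℝ) ≤
                (∑ i ∈ T, x i) ^ 2 / (16 * T.card) + 4 * ∑ i ∈ T, b x i ^ 2 := by
              have h2 : 4 * ((∑ i ∈ T, b x i) ^ 2 / (T.card : ℝ)) ≤ 4 * ∑ i ∈ T, b x i ^ 2 := by
                gcongr
                refine div_le_of_le_mul₀ (by positivity) (by positivity) ?_
                rw [mul_comm]
                exact sq_sum_le_card_mul_sum_sq
              have h3 : (∑ i ∈ T, x i) ^ 2 / (16 * (T.card : ℝ))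
                  + 4 * ((∑ i ∈ T, b x i) ^ 2 / (T.card : ℝ))
                  - (∑ i ∈ T, b x i) * (∑ i ∈ T, x i) / (T.card : ℝ) =
                  ((∑ i ∈ T, x i) / 4 - 2 * ∑ i ∈ T, b x i) ^ 2 / (T.card : ℝ) := by
                rw [← div_div]; ring
              have h4 : 0 ≤ ((∑ i ∈ T, x i) / 4 - 2 * ∑ i ∈ T, b x i) ^ 2 / (T.card : ℝ) := by
                positivity
              linarith
            simp only [hh, ← hT]
            linarith
    · by_cases hi : i ∈ T
      · have hi' : σ i ∈ T := by
          by_contra hc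
          have := σ.injective (hσ _ hc)
          exact hc (by rwa [this])
        rw [(Finset.mem_filter.1 hi').2, (Finset.mem_filter.1 hi).2]
      · rw [hσ i hi]
    · simp only [hh, hbσ σ hσ x, Function.comp]
      congr 1
      · refine Finset.sum_congr rfl fun k hk => ?_
        have hk' : k ≠ k₀ := fun h => hk₀ (h ▸ hk)
        rw [Finset.sum_congr rfl fun i hi => by rw [hσk σ hσ k hk' i hi]]
      · refine Finset.sum_congr rfl fun k hk => Finset.sum_congr rfl fun i hi => ?_
        have hk' : k ≠ k₀ := fun h => by simp [h] at hk
        rw [hσk σ hσ k hk' i hi]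

/-- The part of `A` with rows in `I` and columns outside `I`, padded with zeros. -/
def cutMatrix (A : Matrix ι ι ℝ) (I : Finset ι) : Matrix ι ι ℝ :=
  Matrix.of fun i j => if i ∈ I ∧ j ∉ I then A i j else 0

theorem cutMatrix_mulVec_of_mem (A : Matrix ι ι ℝ) {I : Finset ι} {i : ι} (hi : i ∈ I)
    (x : ι → ℝ) :
    (cutMatrix A I *ᵥ x) i = (A *ᵥ fun j => if j ∈ I then 0 else x j) i := by
  simp only [Matrix.mulVec, dotProduct, cutMatrix, Matrix.of_apply]
  refine Finset.sum_congr rfl fun j _ => ?_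
  by_cases hj : j ∈ I <;> simp [hi, hj]

theorem cutMatrix_mulVec_of_notMem (A : Matrix ι ι ℝ) {I : Finset ι} {i : ι} (hi : i ∉ I)
    (x : ι → ℝ) : (cutMatrix A I *ᵥ x) i = 0 := by
  simp [Matrix.mulVec, dotProduct, cutMatrix, hi]

theorem sum_sq_cutMatrix_le (A : Matrix ι ι ℝ) (I : Finset ι) :
    ∑ i, ∑ j, cutMatrix A I i j ^ 2 ≤ ∑ i, ∑ j, A i j ^ 2 := by
  refine Finset.sum_le_sum fun i _ => Finset.sum_le_sum fun j _ => ?_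
  rw [cutMatrix, Matrix.of_apply]
  split_ifs
  · exact le_rfl
  · simpa using sq_nonneg (A i j)

theorem cutMatrix_mulVec_sq_le {A : Matrix ι ι ℝ} {N : ℝ}
    (hN : ∀ x, A *ᵥ x ⬝ᵥ A *ᵥ x ≤ N ^ 2 * (x ⬝ᵥ x)) (I : Finset ι) (x : ι → ℝ) :
    cutMatrix A I *ᵥ x ⬝ᵥ cutMatrix A I *ᵥ x ≤ N ^ 2 * (x ⬝ᵥ x) := by
  set y : ι → ℝ := fun j => if j ∈ I then 0 else x j with hy
  have h1 : cutMatrix A I *ᵥ x ⬝ᵥ cutMatrix A I *ᵥ x ≤ A *ᵥ y ⬝ᵥ A *ᵥ y := by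
    refine Finset.sum_le_sum fun i _ => ?_
    by_cases hi : i ∈ I
    · rw [cutMatrix_mulVec_of_mem A hi]
    · rw [cutMatrix_mulVec_of_notMem A hi, mul_zero]
      exact mul_self_nonneg _
  have h2 : y ⬝ᵥ y ≤ x ⬝ᵥ x := by
    refine Finset.sum_le_sum fun i _ => ?_
    simp only [hy]
    split_ifs
    · rw [mul_zero]; exact mul_self_nonneg _
    · exact le_rfl
  exact h1.trans ((hN y).trans (mul_le_mul_of_nonneg_left h2 (sq_nonneg N)))

theorem card_cut {i j : ι} (hij : i ≠ j) :
    4 * (#{I : Finset ι | i ∈ I ∧ j ∉ I} : ℝ) = 2 ^ Fintype.card ι := by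
  have h : ({I : Finset ι | i ∈ I ∧ j ∉ I} : Finset (Finset ι)) = Finset.Icc {i} {j}ᶜ := by
    ext I
    simp [Finset.subset_compl_singleton]
  have h2 : 2 ≤ Fintype.card ι := Fintype.one_lt_card_iff.2 ⟨i, j, hij⟩
  rw [h, Finset.card_Icc_finset (by simpa using hij.symm), Finset.card_compl, Finset.card_singleton,
    Finset.card_singleton]
  push_cast
  rw [show (4 : ℝ) = 2 ^ 2 by norm_num, ← pow_add]
  congr 1
  omega

/-- Each ordered pair `i ≠ j` is cut by a quarter of all `I`. -/
theorem sum_cutMatrix_quadratic (A : Matrix ι ι ℝ) (x : ι → ℝ) (hx : ∀ i, x i ^ 2 = 1) :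
    ∑ I : Finset ι, 4 * (x ⬝ᵥ cutMatrix A I *ᵥ x) =
      2 ^ Fintype.card ι * (x ⬝ᵥ A *ᵥ x - A.trace) := by
  have hquad : ∀ B : Matrix ι ι ℝ, x ⬝ᵥ B *ᵥ x = ∑ i, ∑ j, B i j * (x i * x j) := by
    intro B
    simp only [dotProduct, Matrix.mulVec, Finset.mul_sum]
    exact Finset.sum_congr rfl fun i _ => Finset.sum_congr rfl fun j _ => by ring
  have htr : A.trace = ∑ i, ∑ j, if i = j then A i j * (x i * x j) else 0 := by
    simp only [Finset.sum_ite_eq, Finset.mem_univ, if_true, Matrix.trace, Matrix.diag_apply]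
    exact Finset.sum_congr rfl fun i _ => by rw [← sq, hx, mul_one]
  rw [hquad A, htr, ← Finset.sum_sub_distrib]
  simp only [hquad, Finset.mul_sum, ← Finset.sum_sub_distrib]
  rw [Finset.sum_comm]
  refine Finset.sum_congr rfl fun i _ => ?_
  rw [Finset.sum_comm]
  refine Finset.sum_congr rfl fun j _ => ?_
  have h1 : ∀ I : Finset ι, 4 * (cutMatrix A I i j * (x i * x j)) =
      (if i ∈ I ∧ j ∉ I then 1 else 0) * (4 * (A i j * (x i * x j))) := fun I => by
    rw [cutMatrix, Matrix.of_apply]; split_ifs <;> ring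
  simp only [h1]
  rw [← Finset.sum_mul, Finset.sum_boole]
  by_cases hij : i = j
  · subst hij; simp
  · rw [if_neg hij, ← card_cut hij]; ring

/-- Decoupling, by convexity of the exponential. -/
theorem exp_quadratic_le_sum_cutMatrix (A : Matrix ι ι ℝ) (x : ι → ℝ) (hx : ∀ i, x i ^ 2 = 1)
    (lam : ℝ) :
    Real.exp (lam * (x ⬝ᵥ A *ᵥ x - A.trace)) ≤
      ∑ I : Finset ι, (2 ^ Fintype.card ι)⁻¹ *
        Real.exp (4 * lam * (x ⬝ᵥ cutMatrix A I *ᵥ x)) := by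
  have h := convexOn_exp.map_sum_le (t := (Finset.univ : Finset (Finset ι)))
    (w := fun _ => ((2 : ℝ) ^ Fintype.card ι)⁻¹)
    (p := fun I => 4 * lam * (x ⬝ᵥ cutMatrix A I *ᵥ x)) (fun _ _ => by positivity)
    (by simp [Finset.sum_const, Finset.card_univ]) (fun _ _ => Set.mem_univ _)
  simp only [smul_eq_mul] at h
  refine le_trans (Real.exp_le_exp.2 (le_of_eq ?_)) h
  have h1 := sum_cutMatrix_quadratic A x hx
  rw [← Finset.mul_sum]
  have h2 : ∑ I : Finset ι, 4 * lam * (x ⬝ᵥ cutMatrix A I *ᵥ x) =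
      lam * ∑ I : Finset ι, 4 * (x ⬝ᵥ cutMatrix A I *ᵥ x) := by
    rw [Finset.mul_sum]
    exact Finset.sum_congr rfl fun I _ => by ring
  rw [h2, h1]
  field_simp

/-- The normalized indicators of the sets `I ∩ κ⁻¹ k` are orthogonal, so that the squares of the
normalized block sums have a bounded joint exponential moment. -/
theorem HasSubgaussianForms.sum_exp_block_sums_le {Ω : Finset (ι → ℝ)} {m : ι → ℝ}
    (hsub : HasSubgaussianForms Ω m) {M : ℝ} (hM : m ⬝ᵥ m ≤ M) (κ : ι → L) (I : Finset ι) :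
    ∑ x ∈ Ω, Real.exp (∑ k, (∑ i ∈ I with κ i = k, x i) ^ 2 / (8 * #{i ∈ I | κ i = k})) ≤
      Ω.card * Real.exp (Fintype.card L * (1 / 2 + M / 4)) := by
  set b : L → ι → ℝ := fun k i =>
    if i ∈ I ∧ κ i = k then (√(8 * #{i ∈ I | κ i = k}))⁻¹ else 0 with hb
  have hbx : ∀ k (x : ι → ℝ), b k ⬝ᵥ x =
      (√(8 * #{i ∈ I | κ i = k}))⁻¹ * ∑ i ∈ I with κ i = k, x i := by
    intro k x
    simp only [dotProduct, hb, ite_mul, zero_mul]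
    rw [← Finset.sum_filter, Finset.mul_sum]
    congr 1
    ext i
    simp
  have hbx2 : ∀ k (x : ι → ℝ), (b k ⬝ᵥ x) ^ 2 =
      (∑ i ∈ I with κ i = k, x i) ^ 2 / (8 * #{i ∈ I | κ i = k}) := by
    intro k x
    rw [hbx, mul_pow, inv_pow, Real.sq_sqrt (by positivity)]
    ring
  have hbb : ∀ k, b k ⬝ᵥ b k ≤ 1 / 8 := by
    intro k
    have h1 : ∑ i ∈ I with κ i = k, b k i =
        #{i ∈ I | κ i = k} * (√(8 * #{i ∈ I | κ i = k}))⁻¹ := by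
      rw [Finset.sum_congr rfl fun i hi => show b k i = (√(8 * #{i ∈ I | κ i = k}))⁻¹ by
        simp only [hb]; rw [if_pos (Finset.mem_filter.1 hi)], Finset.sum_const, nsmul_eq_mul]
    rw [hbx, h1, mul_left_comm, ← mul_inv, Real.mul_self_sqrt (by positivity), ← div_eq_mul_inv]
    refine div_le_of_le_mul₀ (by positivity) (by norm_num) (by linarith)
  have key := hsub.sum_exp_sum_sq_le b (fun k l hkl => ?_) hbb
  · simp only [hbx2 _] at key
    refine key.trans (mul_le_mul_of_nonneg_left (Real.exp_le_exp.2 ?_) (Nat.cast_nonneg _))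
    rw [← nsmul_eq_mul, ← Finset.card_univ, ← Finset.sum_const]
    refine Finset.sum_le_sum fun k _ => ?_
    rw [← hbx2]
    have hm0 : 0 ≤ m ⬝ᵥ m := Finset.sum_nonneg fun i _ => mul_self_nonneg _
    have h2 : (b k ⬝ᵥ m) ^ 2 ≤ (b k ⬝ᵥ b k) * (m ⬝ᵥ m) := by
      have := Finset.sum_mul_sq_le_sq_mul_sq Finset.univ (b k) m
      simpa only [dotProduct, ← sq] using this
    have h3 : (b k ⬝ᵥ b k) * (m ⬝ᵥ m) ≤ 1 / 8 * M := by gcongr; exact hbb k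
    linarith [hbb k]
  · refine Finset.sum_eq_zero fun i _ => ?_
    simp only [hb]
    by_cases h1 : i ∈ I ∧ κ i = k
    · rw [if_neg (fun h2 : i ∈ I ∧ κ i = l => hkl (h1.2.symm.trans h2.2)), mul_zero]
    · rw [if_neg h1, zero_mul]

/-- The moment generating function of one decoupled form. -/
theorem sum_exp_cutMatrix_le {κ : ι → L} {Ω : Finset (ι → ℝ)} {m : ι → ℝ}
    (hinv : BlockInvariant κ Ω) (hΩ : ∀ x ∈ Ω, ∀ i, x i ^ 2 = 1)
    (hsub : HasSubgaussianForms Ω m) {M : ℝ} (hM : m ⬝ᵥ m ≤ M) {A : Matrix ι ι ℝ} {N lam : ℝ}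
    (hN : ∀ x, A *ᵥ x ⬝ᵥ A *ᵥ x ≤ N ^ 2 * (x ⬝ᵥ x)) (hlam : 1280 * (lam ^ 2 * N ^ 2) ≤ 1)
    (I : Finset ι) :
    ∑ x ∈ Ω, Real.exp (4 * lam * (x ⬝ᵥ cutMatrix A I *ᵥ x)) ≤
      Ω.card * Real.exp (Fintype.card L * (1 / 2 + M / 4)
        + (640 + 320 * M) * (lam ^ 2 * ∑ i, ∑ j, A i j ^ 2)) := by
  have hm0 : 0 ≤ m ⬝ᵥ m := Finset.sum_nonneg fun i _ => mul_self_nonneg _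
  have hM0 : 0 ≤ M := hm0.trans hM
  set F2 := ∑ i, ∑ j, A i j ^ 2 with hF2
  have hF0 : 0 ≤ F2 := Finset.sum_nonneg fun i _ => Finset.sum_nonneg fun j _ => sq_nonneg _
  set B := cutMatrix A I with hB
  have hfib : ∀ f : ι → ℝ, ∑ k, ∑ i ∈ I with κ i = k, f i = ∑ i ∈ I, f i := fun f =>
    Finset.sum_fiberwise I κ f
  have hIsum : ∀ (x y : ι → ℝ), y ⬝ᵥ B *ᵥ x = ∑ i ∈ I, y i * (B *ᵥ x) i := by
    intro x y
    rw [dotProduct]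
    refine (Finset.sum_subset (Finset.subset_univ I) fun i _ hi => ?_).symm
    rw [hB, cutMatrix_mulVec_of_notMem A hi, mul_zero]
  have h1 := hinv.sum_exp_sum_blocks_le
    (fun x hx i => (sq_le_one_iff_abs_le_one _).1 (hΩ x hx i).le) I
    (fun x i => 4 * lam * (B *ᵥ x) i) (fun x y hxy => by
      funext i
      by_cases hi : i ∈ I
      · rw [hB, cutMatrix_mulVec_of_mem A hi, cutMatrix_mulVec_of_mem A hi]
        congr 3
        funext j
        split_ifs with hj
        · rfl
        · exact hxy j hj
      · rw [hB, cutMatrix_mulVec_of_notMem A hi, cutMatrix_mulVec_of_notMem A hi])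
    Finset.univ
  simp only [hfib, Finset.compl_univ, Finset.sum_empty, add_zero, Finset.sum_add_distrib,
    ← Finset.mul_sum] at h1
  have h2 : ∀ x : ι → ℝ, ∑ i ∈ I, 4 * lam * (B *ᵥ x) i * x i = 4 * lam * (x ⬝ᵥ B *ᵥ x) := by
    intro x
    rw [hIsum, Finset.mul_sum]
    exact Finset.sum_congr rfl fun i _ => by ring
  have h3 : ∀ x : ι → ℝ, ∑ i ∈ I, (4 * lam * (B *ᵥ x) i) ^ 2 =
      16 * lam ^ 2 * (B *ᵥ x ⬝ᵥ B *ᵥ x) := by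
    intro x
    rw [hIsum, Finset.mul_sum]
    exact Finset.sum_congr rfl fun i _ => by ring
  simp only [h2, h3] at h1
  have h4 := hsub.sum_exp_block_sums_le hM κ I
  have h5 := hsub.sum_exp_sq_norm_mulVec_le B (N := N) (θ := 160 * lam ^ 2)
    (cutMatrix_mulVec_sq_le hN I) (by positivity) (by linarith)
  set p := Fintype.card L * (1 / 2 + M / 4) with hp
  have hp0 : 0 ≤ p := by positivity
  set q := (640 + 320 * M) * (lam ^ 2 * F2) with hq
  have hq0 : 0 ≤ q := by positivity
  have h6 : 4 * (160 * lam ^ 2) * ∑ i, ∑ j, B i j ^ 2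
      + 2 * (160 * lam ^ 2) * (B *ᵥ m ⬝ᵥ B *ᵥ m) ≤ q := by
    have hBF : ∑ i, ∑ j, B i j ^ 2 ≤ F2 := sum_sq_cutMatrix_le A I
    have h7 : B *ᵥ m ⬝ᵥ B *ᵥ m ≤ F2 * M :=
      (mulVec_sq_le_sum_sq_mul B m).trans (mul_le_mul hBF hM hm0 hF0)
    calc _ ≤ 4 * (160 * lam ^ 2) * F2 + 2 * (160 * lam ^ 2) * (F2 * M) := by gcongr
      _ = q := by rw [hq]; ring
  refine h1.trans ?_
  calc _ ≤ ∑ x ∈ Ω, ((Real.exp (∑ k, (∑ i ∈ I with κ i = k, x i) ^ 2 /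
          (8 * #{i ∈ I | κ i = k})) + Real.exp (160 * lam ^ 2 * (B *ᵥ x ⬝ᵥ B *ᵥ x))) / 2) := by
        refine Finset.sum_le_sum fun x _ => ?_
        -- `exp (u + v) ≤ (exp (2 u) + exp (2 v)) / 2`
        set u := ∑ k, (∑ i ∈ I with κ i = k, x i) ^ 2 / (16 * (#{i ∈ I | κ i = k} : ℝ)) with hu
        have hu2 : ∑ k, (∑ i ∈ I with κ i = k, x i) ^ 2 / (8 * (#{i ∈ I | κ i = k} : ℝ)) =
            u + u := by
          rw [hu, ← Finset.sum_add_distrib]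
          refine Finset.sum_congr rfl fun k _ => ?_
          rw [← div_div, ← div_div]; ring
        rw [hu2, show 160 * lam ^ 2 * (B *ᵥ x ⬝ᵥ B *ᵥ x) =
          5 * (16 * lam ^ 2 * (B *ᵥ x ⬝ᵥ B *ᵥ x)) + 5 * (16 * lam ^ 2 * (B *ᵥ x ⬝ᵥ B *ᵥ x)) by ring,
          Real.exp_add, Real.exp_add, Real.exp_add]
        nlinarith [sq_nonneg (Real.exp u - Real.exp (5 * (16 * lam ^ 2 * (B *ᵥ x ⬝ᵥ B *ᵥ x))))]
    _ ≤ (Ω.card * Real.exp p + Ω.card * Real.exp q) / 2 := by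
        rw [← Finset.sum_div, Finset.sum_add_distrib]
        gcongr
        exact h5.trans (mul_le_mul_of_nonneg_left (Real.exp_le_exp.2 h6) (Nat.cast_nonneg _))
    _ ≤ (Ω.card * Real.exp (p + q) + Ω.card * Real.exp (p + q)) / 2 := by
        gcongr <;> linarith
    _ = _ := by ring

/-- The moment generating function of a quadratic form, centred at the trace, for parameters at most
of the order of `1 / N`, where `N` bounds the operator norm. -/
theorem sum_exp_quadratic_le {κ : ι → L} {Ω : Finset (ι → ℝ)} {m : ι → ℝ}
    (hinv : BlockInvariant κ Ω) (hΩ : ∀ x ∈ Ω, ∀ i, x i ^ 2 = 1)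
    (hsub : HasSubgaussianForms Ω m) {M : ℝ} (hM : m ⬝ᵥ m ≤ M) {A : Matrix ι ι ℝ} {N lam : ℝ}
    (hN : ∀ x, A *ᵥ x ⬝ᵥ A *ᵥ x ≤ N ^ 2 * (x ⬝ᵥ x)) (hlam : 1280 * (lam ^ 2 * N ^ 2) ≤ 1) :
    ∑ x ∈ Ω, Real.exp (lam * (x ⬝ᵥ A *ᵥ x - A.trace)) ≤
      Ω.card * Real.exp (Fintype.card L * (1 / 2 + M / 4)
        + (640 + 320 * M) * (lam ^ 2 * ∑ i, ∑ j, A i j ^ 2)) := by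
  refine (Finset.sum_le_sum fun x hx =>
    exp_quadratic_le_sum_cutMatrix A x (hΩ x hx) lam).trans ?_
  rw [Finset.sum_comm]
  simp only [← Finset.mul_sum]
  refine (mul_le_mul_of_nonneg_left (Finset.sum_le_sum fun I _ =>
    sum_exp_cutMatrix_le hinv hΩ hsub hM hN hlam I) (by positivity)).trans (le_of_eq ?_)
  rw [Finset.sum_const, Finset.card_univ, Fintype.card_finset, nsmul_eq_mul]
  push_cast
  rw [inv_mul_cancel_left₀ (by positivity)]

end Decoupling

/-! ### Uniform distributions on finite sets -/

section UniformOn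

variable {α β : Type*} [MeasurableSpace α] [MeasurableSingletonClass α]
  [MeasurableSpace β] [MeasurableSingletonClass β]

theorem uniformOn_coe_apply (s : Finset α) (t : Set α) [DecidablePred (· ∈ t)] :
    uniformOn (s : Set α) t = (#s : ENNReal)⁻¹ * #{a ∈ s | a ∈ t} := by
  have h : (s : Set α) ∩ t = ↑(s.filter (· ∈ t)) := by ext; simp
  rw [uniformOn, cond_apply s.measurableSet, h, Measure.count_apply_finset,
    Measure.count_apply_finset]

theorem uniformOn_coe_eq_smul_sum_dirac (s : Finset α) :
    uniformOn (s : Set α) = (#s : ENNReal)⁻¹ • ∑ a ∈ s, Measure.dirac a := by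
  classical
  ext t ht
  rw [uniformOn_coe_apply, Measure.smul_apply, Measure.finsetSum_apply, smul_eq_mul]
  simp [Measure.dirac_apply, Set.indicator_apply]

theorem integrable_uniformOn_coe (s : Finset α) (f : α → ℝ) :
    Integrable f (uniformOn (s : Set α)) := by
  rcases s.eq_empty_or_nonempty with rfl | hs
  · simp
  rw [uniformOn_coe_eq_smul_sum_dirac]
  refine Integrable.smul_measure ?_ (by simp [hs.ne_empty])
  exact integrable_finsetSum_measure.2 fun a _ => integrable_dirac (by simp)

theorem integral_uniformOn_coe (s : Finset α) (f : α → ℝ) :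
    ∫ a, f a ∂(uniformOn (s : Set α)) = (∑ a ∈ s, f a) / #s := by
  rw [uniformOn_coe_eq_smul_sum_dirac, integral_smul_measure,
    integral_finsetSum_measure fun a _ => integrable_dirac (by simp)]
  simp [div_eq_inv_mul]

theorem uniformOn_prod_uniformOn {s : Finset α} {t : Finset β} (hs : s.Nonempty)
    (ht : t.Nonempty) :
    (uniformOn (s : Set α)).prod (uniformOn (t : Set β)) =
      uniformOn ((s ×ˢ t : Finset (α × β)) : Set (α × β)) := by
  classical
  have := isProbabilityMeasure_uniformOn s.finite_toSet hs
  have := isProbabilityMeasure_uniformOn t.finite_toSet ht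
  refine Measure.prod_eq fun a b _ _ => ?_
  rw [uniformOn_coe_apply, uniformOn_coe_apply, uniformOn_coe_apply]
  have h : (s ×ˢ t).filter (· ∈ a ×ˢ b) = s.filter (· ∈ a) ×ˢ t.filter (· ∈ b) := by
    ext p
    simp only [Finset.mem_filter, Finset.mem_product, Set.mem_prod]
    tauto
  rw [h, Finset.card_product, Finset.card_product]
  push_cast
  rw [ENNReal.mul_inv (by simp [hs.ne_empty]) (by simp)]
  ring

theorem map_uniformOn_coe [DecidableEq β] (s : Finset α) {f : α → β} (hf : Measurable f)
    (hinj : Function.Injective f) :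
    (uniformOn (s : Set α)).map f = uniformOn ((s.image f : Finset β) : Set β) := by
  classical
  ext t ht
  rw [Measure.map_apply hf ht, uniformOn_coe_apply, uniformOn_coe_apply,
    Finset.filter_image, Finset.card_image_of_injective _ hinj,
    Finset.card_image_of_injective _ hinj]
  rfl

/-- Chernoff's bound for both tails. -/
theorem uniformOn_real_abs_ge_le {s : Finset α} (hs : s.Nonempty) (Y : α → ℝ) {lam R : ℝ}
    (hlam : 0 ≤ lam) (h₁ : ∑ a ∈ s, Real.exp (lam * Y a) ≤ #s * R)
    (h₂ : ∑ a ∈ s, Real.exp (-lam * Y a) ≤ #s * R) (t : ℝ) :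
    (uniformOn (s : Set α)).real {a | t ≤ |Y a|} ≤ 2 * (Real.exp (-(lam * t)) * R) := by
  have := isProbabilityMeasure_uniformOn s.finite_toSet hs
  have hcard : (0 : ℝ) < #s := by exact_mod_cast hs.card_pos
  have hone : ∀ Z : α → ℝ, ∑ a ∈ s, Real.exp (lam * Z a) ≤ #s * R →
      (uniformOn (s : Set α)).real {a | t ≤ Z a} ≤ Real.exp (-(lam * t)) * R := by
    intro Z hZ
    refine (measure_ge_le_exp_mul_mgf t hlam (integrable_uniformOn_coe _ _)).trans ?_
    rw [mgf, integral_uniformOn_coe, neg_mul]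
    gcongr
    rw [div_le_iff₀ hcard]
    linarith
  have hsub : {a | t ≤ |Y a|} ⊆ {a | t ≤ Y a} ∪ {a | t ≤ -Y a} := fun a (ha : t ≤ |Y a|) =>
    le_abs.1 ha
  refine (measureReal_mono hsub).trans ((measureReal_union_le _ _).trans ?_)
  rw [two_mul]
  exact add_le_add (hone Y h₁) (hone (fun a => -Y a) (by simpa using h₂))

end UniformOn

/-! ### The product of a cube and two slices -/

/-- The cube as a finset. -/
noncomputable def cubeFinset (d : ℕ) : Finset (Fin d → ℝ) := (boolCube_finite d).toFinset

/-- The slice as a finset. -/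
noncomputable def sliceFinset (d : ℕ) (μ : ℝ) : Finset (Fin d → ℝ) :=
  (boolSlice_finite d μ).toFinset

/-- The support of `cubeSliceLaw`, as a finset. -/
noncomputable def cubeSliceFinset (d₁ d₂ d₃ : ℕ) (μ ν : ℝ) : Finset (BlockIdx d₁ d₂ d₃ → ℝ) :=
  open Classical in
  (cubeFinset d₁ ×ˢ (sliceFinset d₂ μ ×ˢ sliceFinset d₃ ν)).image concatBlocks

theorem mem_cubeFinset {d : ℕ} {x : Fin d → ℝ} :
    x ∈ cubeFinset d ↔ ∀ i, x i = 1 ∨ x i = -1 := by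
  rw [cubeFinset, Set.Finite.mem_toFinset]; rfl

theorem mem_sliceFinset {d : ℕ} {μ : ℝ} {x : Fin d → ℝ} :
    x ∈ sliceFinset d μ ↔ (∀ i, x i = 1 ∨ x i = -1) ∧ ∑ i, x i = μ * d := by
  rw [sliceFinset, Set.Finite.mem_toFinset]; rfl

theorem concatBlocks_injective {d₁ d₂ d₃ : ℕ} :
    Function.Injective
      (concatBlocks : (Fin d₁ → ℝ) × (Fin d₂ → ℝ) × (Fin d₃ → ℝ) → _) := by
  rintro ⟨x₁, x₂, x₃⟩ ⟨y₁, y₂, y₃⟩ h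
  refine Prod.ext ?_ (Prod.ext ?_ ?_)
  · exact funext fun i => congrFun h (Sum.inl i)
  · exact funext fun i => congrFun h (Sum.inr (Sum.inl i))
  · exact funext fun i => congrFun h (Sum.inr (Sum.inr i))

theorem mem_cubeSliceFinset {d₁ d₂ d₃ : ℕ} {μ ν : ℝ} {x : BlockIdx d₁ d₂ d₃ → ℝ} :
    x ∈ cubeSliceFinset d₁ d₂ d₃ μ ν ↔ (∀ i, x i = 1 ∨ x i = -1) ∧
      ∑ j, x (Sum.inr (Sum.inl j)) = μ * d₂ ∧ ∑ j, x (Sum.inr (Sum.inr j)) = ν * d₃ := by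
  classical
  simp only [cubeSliceFinset, Finset.mem_image, Finset.mem_product, mem_cubeFinset,
    mem_sliceFinset]
  constructor
  · rintro ⟨⟨x₁, x₂, x₃⟩, ⟨h₁, ⟨h₂, h₂'⟩, h₃, h₃'⟩, rfl⟩
    refine ⟨?_, h₂', h₃'⟩
    rintro (i | i | i)
    exacts [h₁ i, h₂ i, h₃ i]
  · rintro ⟨h, h₂, h₃⟩
    refine ⟨(fun i => x (Sum.inl i), fun i => x (Sum.inr (Sum.inl i)),
      fun i => x (Sum.inr (Sum.inr i))), ⟨fun i => h _, ⟨fun i => h _, h₂⟩, fun i => h _, h₃⟩, ?_⟩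
    funext i
    rcases i with i | i | i <;> rfl

theorem cubeFinset_nonempty (d : ℕ) : (cubeFinset d).Nonempty := by
  rw [cubeFinset, Set.Finite.toFinset_nonempty]; exact boolCube_nonempty d

theorem sliceFinset_nonempty {d : ℕ} {μ : ℝ} (h : (boolSlice d μ).Nonempty) :
    (sliceFinset d μ).Nonempty := by
  rwa [sliceFinset, Set.Finite.toFinset_nonempty]

theorem cubeSliceFinset_nonempty (d₁ : ℕ) {d₂ d₃ : ℕ} {μ ν : ℝ}
    (h₂ : (boolSlice d₂ μ).Nonempty) (h₃ : (boolSlice d₃ ν).Nonempty) :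
    (cubeSliceFinset d₁ d₂ d₃ μ ν).Nonempty :=
  ((cubeFinset_nonempty d₁).product
    ((sliceFinset_nonempty h₂).product (sliceFinset_nonempty h₃))).image _

theorem cubeSliceLaw_eq_uniformOn (d₁ : ℕ) {d₂ d₃ : ℕ} {μ ν : ℝ}
    (h₂ : (boolSlice d₂ μ).Nonempty) (h₃ : (boolSlice d₃ ν).Nonempty) :
    cubeSliceLaw d₁ d₂ d₃ μ ν = uniformOn (cubeSliceFinset d₁ d₂ d₃ μ ν : Set _) := by
  classical
  have e₁ : boolCube d₁ = (cubeFinset d₁ : Set _) := (Set.Finite.coe_toFinset _).symm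
  have e₂ : boolSlice d₂ μ = (sliceFinset d₂ μ : Set _) := (Set.Finite.coe_toFinset _).symm
  have e₃ : boolSlice d₃ ν = (sliceFinset d₃ ν : Set _) := (Set.Finite.coe_toFinset _).symm
  rw [cubeSliceLaw, e₁, e₂, e₃,
    uniformOn_prod_uniformOn (sliceFinset_nonempty h₂) (sliceFinset_nonempty h₃),
    uniformOn_prod_uniformOn (cubeFinset_nonempty d₁)
      ((sliceFinset_nonempty h₂).product (sliceFinset_nonempty h₃)),
    map_uniformOn_coe _ measurable_concatBlocks concatBlocks_injective]
  congr

theorem hasSubgaussianForms_cubeFinset (d : ℕ) : HasSubgaussianForms (cubeFinset d) 0 := by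
  classical
  intro v
  have hne : (1 : ℝ) ≠ -1 := by norm_num
  have e : cubeFinset d = Fintype.piFinset fun _ : Fin d => ({1, -1} : Finset ℝ) := by
    ext x
    simp [mem_cubeFinset]
  have hcard : ((cubeFinset d).card : ℝ) = ∏ _i : Fin d, (2 : ℝ) := by
    rw [e, Fintype.card_piFinset]
    simp [Finset.card_pair hne]
  have h : ∑ x ∈ cubeFinset d, Real.exp (v ⬝ᵥ x) = ∏ i, (2 * Real.cosh (v i)) := by
    simp only [dotProduct, Real.exp_sum]
    rw [e, ← Finset.prod_univ_sum (fun _ : Fin d => ({1, -1} : Finset ℝ))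
      (fun i y => Real.exp (v i * y))]
    refine Finset.prod_congr rfl fun i _ => ?_
    rw [Finset.sum_pair hne, mul_one, mul_neg_one, Real.cosh_eq]
    ring
  rw [h, hcard, dotProduct_zero, zero_add, dotProduct, Real.exp_sum, ← Finset.prod_mul_distrib]
  refine Finset.prod_le_prod (fun i _ => by have := Real.cosh_pos (v i); positivity) fun i _ => ?_
  refine mul_le_mul_of_nonneg_left ((Real.cosh_le_exp_half_sq _).trans ?_) zero_le_two
  refine Real.exp_le_exp.2 ?_
  nlinarith [sq_nonneg (v i)]

/-- The slice is invariant under all permutations, and its empirical mean is constantly `μ`. -/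
theorem hasSubgaussianForms_sliceFinset (d : ℕ) (μ : ℝ) :
    HasSubgaussianForms (sliceFinset d μ) fun _ => μ := by
  intro v
  have key := sum_exp_block_le (sliceFinset d μ) Finset.univ
    (fun x hx i => by
      rcases (mem_sliceFinset.1 hx).1 i with h | h <;> simp [h])
    (fun σ _ x hx => by
      rw [mem_sliceFinset] at hx ⊢
      exact ⟨fun i => hx.1 _, (Equiv.sum_comp σ x).trans hx.2⟩)
    (fun _ => v) (fun _ => 0) (fun _ _ _ => rfl) (fun _ _ _ => rfl)
  simp only [add_zero] at key
  refine key.trans (le_of_eq ?_)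
  rw [← nsmul_eq_mul, ← Finset.sum_const]
  refine Finset.sum_congr rfl fun x hx => ?_
  rw [(mem_sliceFinset.1 hx).2, Finset.card_univ, Fintype.card_fin]
  congr 2
  · rw [dotProduct, ← Finset.sum_mul]
    rcases Nat.eq_zero_or_pos d with rfl | hd
    · simp
    · field_simp
  · exact Finset.sum_congr rfl fun i _ => sq _

theorem dotProduct_concatBlocks {d₁ d₂ d₃ : ℕ} (v : BlockIdx d₁ d₂ d₃ → ℝ)
    (p : (Fin d₁ → ℝ) × (Fin d₂ → ℝ) × (Fin d₃ → ℝ)) :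
    v ⬝ᵥ concatBlocks p = (v ∘ Sum.inl) ⬝ᵥ p.1 +
      ((v ∘ Sum.inr ∘ Sum.inl) ⬝ᵥ p.2.1 + (v ∘ Sum.inr ∘ Sum.inr) ⬝ᵥ p.2.2) := by
  simp only [dotProduct, Fintype.sum_sum_type]
  rfl

theorem hasSubgaussianForms_cubeSliceFinset (d₁ d₂ d₃ : ℕ) (μ ν : ℝ) :
    HasSubgaussianForms (cubeSliceFinset d₁ d₂ d₃ μ ν) (blockMean d₁ d₂ d₃ μ ν) := by
  classical
  intro v
  set v₁ := v ∘ Sum.inl with hv₁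
  set v₂ := v ∘ Sum.inr ∘ Sum.inl with hv₂
  set v₃ := v ∘ Sum.inr ∘ Sum.inr with hv₃
  have hm : v ⬝ᵥ blockMean d₁ d₂ d₃ μ ν =
      v₁ ⬝ᵥ 0 + ((v₂ ⬝ᵥ fun _ => μ) + (v₃ ⬝ᵥ fun _ => ν)) :=
    dotProduct_concatBlocks v (0, fun _ => μ, fun _ => ν)
  have hv : v ⬝ᵥ v = v₁ ⬝ᵥ v₁ + (v₂ ⬝ᵥ v₂ + v₃ ⬝ᵥ v₃) := by
    simp only [dotProduct, Fintype.sum_sum_type]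
    rfl
  have hsum : ∑ x ∈ cubeSliceFinset d₁ d₂ d₃ μ ν, Real.exp (v ⬝ᵥ x) =
      (∑ x ∈ cubeFinset d₁, Real.exp (v₁ ⬝ᵥ x)) *
        ((∑ x ∈ sliceFinset d₂ μ, Real.exp (v₂ ⬝ᵥ x)) *
          ∑ x ∈ sliceFinset d₃ ν, Real.exp (v₃ ⬝ᵥ x)) := by
    rw [cubeSliceFinset, Finset.sum_image concatBlocks_injective.injOn,
      Finset.sum_mul_sum, Finset.sum_mul_sum, ← Finset.sum_product']
    simp only [Finset.sum_product, dotProduct_concatBlocks, Real.exp_add, Finset.mul_sum]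
    rfl
  have hcard : ((cubeSliceFinset d₁ d₂ d₃ μ ν).card : ℝ) =
      (cubeFinset d₁).card * ((sliceFinset d₂ μ).card * (sliceFinset d₃ ν).card) := by
    rw [cubeSliceFinset, Finset.card_image_of_injective _ concatBlocks_injective,
      Finset.card_product, Finset.card_product]
    push_cast; rfl
  rw [hsum, hcard]
  calc _ ≤ ((cubeFinset d₁).card * Real.exp (v₁ ⬝ᵥ 0 + v₁ ⬝ᵥ v₁)) *
        (((sliceFinset d₂ μ).card * Real.exp ((v₂ ⬝ᵥ fun _ => μ) + v₂ ⬝ᵥ v₂)) *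
          ((sliceFinset d₃ ν).card * Real.exp ((v₃ ⬝ᵥ fun _ => ν) + v₃ ⬝ᵥ v₃))) := by
        gcongr
        · exact hasSubgaussianForms_cubeFinset d₁ v₁
        · exact hasSubgaussianForms_sliceFinset d₂ μ v₂
        · exact hasSubgaussianForms_sliceFinset d₃ ν v₃
    _ = _ := by
        rw [hm, hv]
        simp only [Real.exp_add]
        ring

/-- The block containing a coordinate, with the cube as block `0` and the slices as blocks `1` and
`2`. -/
def blockOf {d₁ d₂ d₃ : ℕ} : BlockIdx d₁ d₂ d₃ → Fin 3 :=
  Sum.elim (fun _ => 0) (Sum.elim (fun _ => 1) (fun _ => 2))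

theorem blockInvariant_cubeSliceFinset (d₁ d₂ d₃ : ℕ) (μ ν : ℝ) :
    BlockInvariant blockOf (cubeSliceFinset d₁ d₂ d₃ μ ν) := by
  intro σ hσ x hx
  rw [mem_cubeSliceFinset] at hx ⊢
  have hblock : ∀ k, ∑ i, (if blockOf i = k then (x ∘ σ) i else 0) =
      ∑ i, if blockOf i = k then x i else 0 := by
    intro k
    rw [← Equiv.sum_comp σ fun i => if blockOf i = k then x i else 0]
    exact Finset.sum_congr rfl fun i _ => by rw [hσ i]; rfl
  refine ⟨fun i => hx.1 _, ?_, ?_⟩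
  · rw [← hx.2.1]
    simpa [Fintype.sum_sum_type, blockOf] using hblock 1
  · rw [← hx.2.2]
    simpa [Fintype.sum_sum_type, blockOf] using hblock 2

theorem mulVec_sq_le_matOpNorm {ι : Type*} [Fintype ι] [DecidableEq ι] (A : Matrix ι ι ℝ)
    (x : ι → ℝ) : A *ᵥ x ⬝ᵥ A *ᵥ x ≤ matOpNorm A ^ 2 * (x ⬝ᵥ x) := by
  have h := (Matrix.toEuclideanCLM (n := ι) (𝕜 := ℝ) A).le_opNorm (WithLp.toLp 2 x)
  have h2 := pow_le_pow_left₀ (norm_nonneg _) h 2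
  rw [mul_pow, EuclideanSpace.real_norm_sq_eq, EuclideanSpace.real_norm_sq_eq] at h2
  simpa [dotProduct, ← sq, matOpNorm] using h2

theorem blockMean_dotProduct_self_le {d₁ d₂ d₃ : ℕ} {μ ν c : ℝ} (hμ : |μ| * √d₂ ≤ c)
    (hν : |ν| * √d₃ ≤ c) :
    blockMean d₁ d₂ d₃ μ ν ⬝ᵥ blockMean d₁ d₂ d₃ μ ν ≤ 2 * c ^ 2 := by
  have h : ∀ (r : ℝ) (d : ℕ), |r| * √d ≤ c → d * (r * r) ≤ c ^ 2 := by
    intro r d hr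
    have := pow_le_pow_left₀ (by positivity) hr 2
    rw [mul_pow, sq_abs, Real.sq_sqrt (Nat.cast_nonneg d)] at this
    linarith
  have := h μ d₂ hμ
  have := h ν d₃ hν
  simp only [dotProduct, blockMean, Fintype.sum_sum_type, Sum.elim_inl, Sum.elim_inr, mul_zero,
    Finset.sum_const_zero, Finset.sum_const, Finset.card_univ, Fintype.card_fin, nsmul_eq_mul]
  linarith

/-! ### Tail bounds -/

theorem HasSubgaussianForms.uniformOn_real_linear_le {ι : Type*} [Fintype ι]
    {Ω : Finset (ι → ℝ)} {m : ι → ℝ} (hsub : HasSubgaussianForms Ω m) (hne : Ω.Nonempty)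
    (v : ι → ℝ) (t : ℝ) (ht : 0 < t) :
    (uniformOn (Ω : Set (ι → ℝ))).real {x | t ≤ |v ⬝ᵥ x - v ⬝ᵥ m|} ≤
      2 * Real.exp (-(1 / 4 * (t ^ 2 / ∑ i, v i ^ 2))) := by
  have hvv : v ⬝ᵥ v = ∑ i, v i ^ 2 := Finset.sum_congr rfl fun i _ => (sq _).symm
  set V := ∑ i, v i ^ 2 with hV
  have hV0 : 0 ≤ V := Finset.sum_nonneg fun i _ => sq_nonneg _
  have hmgf : ∀ s : ℝ, ∑ x ∈ Ω, Real.exp (s * (v ⬝ᵥ x - v ⬝ᵥ m)) ≤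
      Ω.card * Real.exp (s ^ 2 * V) := by
    intro s
    have h := hsub (s • v)
    simp only [smul_dotProduct, dotProduct_smul, smul_eq_mul, hvv] at h
    calc _ = Real.exp (-(s * (v ⬝ᵥ m))) * ∑ x ∈ Ω, Real.exp (s * (v ⬝ᵥ x)) := by
          rw [Finset.mul_sum]
          refine Finset.sum_congr rfl fun x _ => ?_
          rw [← Real.exp_add]; congr 1; ring
      _ ≤ Real.exp (-(s * (v ⬝ᵥ m))) * (Ω.card * Real.exp (s * (v ⬝ᵥ m) + s * (s * V))) := by
          gcongr
      _ = _ := by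
          rw [mul_left_comm, ← Real.exp_add]; congr 2; ring
  -- For `v = 0` the parameter is `t / 0 = 0`, and the bound is trivial.
  have key := uniformOn_real_abs_ge_le hne (fun x => v ⬝ᵥ x - v ⬝ᵥ m)
    (lam := t / (2 * V)) (by positivity) (hmgf _) (by simpa using hmgf (-(t / (2 * V)))) t
  rw [← Real.exp_add] at key
  refine key.trans (le_of_eq ?_)
  congr 2
  rcases hV0.eq_or_lt with h | h
  · simp [← h]
  · field_simp; ring

/-- The tail bound for a quadratic form under the uniform distribution on a block-invariant set of
sign vectors with subgaussian linear forms. -/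
theorem uniformOn_real_quadratic_le {ι L : Type*} [Fintype ι] [DecidableEq ι] [Fintype L]
    [DecidableEq L] {κ : ι → L} {Ω : Finset (ι → ℝ)} {m : ι → ℝ}
    (hinv : BlockInvariant κ Ω) (hΩ : ∀ x ∈ Ω, ∀ i, x i ^ 2 = 1)
    (hsub : HasSubgaussianForms Ω m) (hne : Ω.Nonempty) {M : ℝ} (hM : m ⬝ᵥ m ≤ M)
    (A : Matrix ι ι ℝ) (t : ℝ) (ht : 0 < t) :
    (uniformOn (Ω : Set (ι → ℝ))).real
        {x | t < |x ⬝ᵥ A *ᵥ x - ∫ y, y ⬝ᵥ A *ᵥ y ∂(uniformOn (Ω : Set (ι → ℝ)))|} ≤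
      2 * Real.exp (2 * (Fintype.card L * (1 / 2 + M / 4))) *
        Real.exp (-((8 * (640 + 320 * M))⁻¹ *
          min (t / matOpNorm A) (t ^ 2 / matFrobNorm A ^ 2))) := by
  have hM0 : 0 ≤ M := (Finset.sum_nonneg fun i _ => mul_self_nonneg _).trans hM
  have hcard : (0 : ℝ) < Ω.card := by exact_mod_cast hne.card_pos
  have := isProbabilityMeasure_uniformOn Ω.finite_toSet hne
  have hF2 : matFrobNorm A ^ 2 = ∑ i, ∑ j, A i j ^ 2 :=
    Real.sq_sqrt (Finset.sum_nonneg fun i _ => Finset.sum_nonneg fun j _ => sq_nonneg _)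
  rw [hF2]
  set F2 := ∑ i, ∑ j, A i j ^ 2 with hF2def
  have hF0 : 0 ≤ F2 := Finset.sum_nonneg fun i _ => Finset.sum_nonneg fun j _ => sq_nonneg _
  set N := matOpNorm A with hNdef
  have hN0 : 0 ≤ N := norm_nonneg _
  set p := Fintype.card L * (1 / 2 + M / 4) with hp
  have hp0 : 0 ≤ p := by positivity
  set C₀ := 640 + 320 * M with hC₀
  have hC₀' : 640 ≤ C₀ := by linarith
  set μf := ∫ y, y ⬝ᵥ A *ᵥ y ∂(uniformOn (Ω : Set (ι → ℝ))) with hμf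
  -- If one of the norms vanishes, the right-hand side is at least `1`.
  by_cases hzero : N = 0 ∨ F2 = 0
  · have hmin : min (t / N) (t ^ 2 / F2) = 0 := by
      rcases hzero with h | h
      · rw [h, div_zero, min_eq_left (by positivity)]
      · rw [h, div_zero, min_eq_right (by positivity)]
    rw [hmin, mul_zero, neg_zero, Real.exp_zero, mul_one]
    refine measureReal_le_one.trans ?_
    have := Real.one_le_exp (show 0 ≤ 2 * p by positivity)
    linarith
  push Not at hzero
  have hNpos : 0 < N := lt_of_le_of_ne hN0 (Ne.symm hzero.1)
  have hFpos : 0 < F2 := lt_of_le_of_ne hF0 (Ne.symm hzero.2)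
  have hmgf : ∀ s : ℝ, 1280 * (s ^ 2 * N ^ 2) ≤ 1 →
      ∑ x ∈ Ω, Real.exp (s * (x ⬝ᵥ A *ᵥ x - A.trace)) ≤
        Ω.card * Real.exp (p + C₀ * (s ^ 2 * F2)) := fun s hs =>
    sum_exp_quadratic_le hinv hΩ hsub hM (mulVec_sq_le_matOpNorm A) hs
  -- Jensen's inequality, applied with `-s`, replaces the trace by the expectation.
  have hjensen : ∀ s : ℝ, 1280 * (s ^ 2 * N ^ 2) ≤ 1 →
      Real.exp (s * (A.trace - μf)) ≤ Real.exp (p + C₀ * (s ^ 2 * F2)) := by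
    intro s hs
    have h1 := hmgf (-s) (by rwa [neg_sq])
    rw [neg_sq] at h1
    have h2 := convexOn_exp.map_sum_le (t := Ω) (w := fun _ => (Ω.card : ℝ)⁻¹)
      (p := fun x => -s * (x ⬝ᵥ A *ᵥ x - A.trace)) (fun _ _ => by positivity)
      (by rw [Finset.sum_const, nsmul_eq_mul, mul_inv_cancel₀ hcard.ne'])
      (fun _ _ => Set.mem_univ _)
    simp only [smul_eq_mul] at h2
    rw [← Finset.mul_sum, ← Finset.mul_sum, ← Finset.mul_sum, Finset.sum_sub_distrib,
      Finset.sum_const, nsmul_eq_mul] at h2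
    calc Real.exp (s * (A.trace - μf))
        = Real.exp ((Ω.card : ℝ)⁻¹ *
            (-s * (∑ x ∈ Ω, x ⬝ᵥ A *ᵥ x - Ω.card * A.trace))) := by
          rw [hμf, integral_uniformOn_coe]
          congr 1
          field_simp
          ring
      _ ≤ _ := h2
      _ ≤ _ := by rwa [inv_mul_le_iff₀ hcard]
  have hcent : ∀ s : ℝ, 1280 * (s ^ 2 * N ^ 2) ≤ 1 →
      ∑ x ∈ Ω, Real.exp (s * (x ⬝ᵥ A *ᵥ x - μf)) ≤
        Ω.card * Real.exp (2 * p + 2 * C₀ * (s ^ 2 * F2)) := by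
    intro s hs
    calc _ = (∑ x ∈ Ω, Real.exp (s * (x ⬝ᵥ A *ᵥ x - A.trace))) *
          Real.exp (s * (A.trace - μf)) := by
          rw [Finset.sum_mul]
          refine Finset.sum_congr rfl fun x _ => ?_
          rw [← Real.exp_add]; congr 1; ring
      _ ≤ (Ω.card * Real.exp (p + C₀ * (s ^ 2 * F2))) * Real.exp (p + C₀ * (s ^ 2 * F2)) := by
          gcongr
          · exact hmgf s hs
          · exact Real.exp_le_exp.1 (hjensen s hs)
      _ = _ := by rw [mul_assoc, ← Real.exp_add]; congr 2; ring
  -- The first bound makes the Gaussian term at most half of the linear one; the second keeps `lam`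
  -- in the range of the moment estimate, as `1280 ≤ 36 ^ 2`.
  set lam := min (t / (4 * C₀ * F2)) (1 / (36 * N)) with hlamdef
  have hlam0 : 0 ≤ lam := le_min (by positivity) (by positivity)
  have hlamN : 1280 * (lam ^ 2 * N ^ 2) ≤ 1 := by
    have h1 : lam * N ≤ 1 / 36 := by
      calc lam * N ≤ 1 / (36 * N) * N := by gcongr; exact min_le_right _ _
        _ = 1 / 36 := by field_simp
    have h2 : (lam * N) ^ 2 ≤ (1 / 36) ^ 2 := pow_le_pow_left₀ (by positivity) h1 2
    rw [mul_pow] at h2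
    linarith
  have hlamF : 2 * C₀ * (lam ^ 2 * F2) ≤ lam * t / 2 := by
    have h1 : lam * (4 * C₀ * F2) ≤ t := by
      rw [← le_div_iff₀ (by positivity)]; exact min_le_left _ _
    linarith [mul_le_mul_of_nonneg_left h1 hlam0]
  have hlamt : (8 * C₀)⁻¹ * min (t / N) (t ^ 2 / F2) ≤ lam * t / 2 := by
    rcases min_choice (t / (4 * C₀ * F2)) (1 / (36 * N)) with h | h
    · calc (8 * C₀)⁻¹ * min (t / N) (t ^ 2 / F2) ≤ (8 * C₀)⁻¹ * (t ^ 2 / F2) := by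
            gcongr; exact min_le_right _ _
        _ = lam * t / 2 := by rw [hlamdef, h]; field_simp; ring
    · calc (8 * C₀)⁻¹ * min (t / N) (t ^ 2 / F2) ≤ (72 : ℝ)⁻¹ * (t / N) := by
            gcongr
            · linarith
            · exact min_le_left _ _
        _ = lam * t / 2 := by rw [hlamdef, h]; field_simp; ring
  have key := uniformOn_real_abs_ge_le hne (fun x => x ⬝ᵥ A *ᵥ x - μf) hlam0 (hcent lam hlamN)
    (by simpa using hcent (-lam) (by rwa [neg_sq])) t
  calc _ ≤ (uniformOn (Ω : Set (ι → ℝ))).real {x | t ≤ |x ⬝ᵥ A *ᵥ x - μf|} :=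
        measureReal_mono fun x (hx : t < _) => le_of_lt hx
    _ ≤ _ := key
    _ ≤ _ := by
        rw [← Real.exp_add, mul_assoc 2 (Real.exp _), ← Real.exp_add]
        refine mul_le_mul_of_nonneg_left (Real.exp_le_exp.2 ?_) zero_le_two
        linarith

theorem theorem5p4 :
    -- linear forms are subgaussian
    (∃ c₀ : ℝ, 0 < c₀ ∧
      ∀ (d₁ d₂ d₃ : ℕ) (μ ν : ℝ),
        (boolSlice d₂ μ).Nonempty → (boolSlice d₃ ν).Nonempty →
        ∀ (v : BlockIdx d₁ d₂ d₃ → ℝ) (t : ℝ), 0 < t →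
          (cubeSliceLaw d₁ d₂ d₃ μ ν).real
              {x | t ≤ |v ⬝ᵥ x - v ⬝ᵥ blockMean d₁ d₂ d₃ μ ν|}
            ≤ 2 * Real.exp (-(c₀ * (t ^ 2 / ∑ i, v i ^ 2)))) ∧
    -- the tail bound for quadratic forms
    (∀ c : ℝ, 0 < c → ∃ C K : ℝ, 0 < C ∧ 0 < K ∧
      ∀ (d₁ d₂ d₃ : ℕ) (μ ν : ℝ),
        (boolSlice d₂ μ).Nonempty → (boolSlice d₃ ν).Nonempty →
        |μ| * Real.sqrt d₂ ≤ c → |ν| * Real.sqrt d₃ ≤ c →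
        ∀ (A : Matrix (BlockIdx d₁ d₂ d₃) (BlockIdx d₁ d₂ d₃) ℝ) (t : ℝ), 0 < t →
          (cubeSliceLaw d₁ d₂ d₃ μ ν).real
              {x | t < |x ⬝ᵥ A *ᵥ x - ∫ y, y ⬝ᵥ A *ᵥ y ∂(cubeSliceLaw d₁ d₂ d₃ μ ν)|}
            ≤ K * Real.exp (-(C * min (t / matOpNorm A) (t ^ 2 / matFrobNorm A ^ 2)))) := by
  refine ⟨⟨1 / 4, by norm_num, fun d₁ d₂ d₃ μ ν h₂ h₃ v t ht => ?_⟩, fun c _ =>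
    ⟨(8 * (640 + 320 * (2 * c ^ 2)))⁻¹,
      2 * Real.exp (2 * (Fintype.card (Fin 3) * (1 / 2 + (2 * c ^ 2) / 4))), by positivity,
      by positivity, fun d₁ d₂ d₃ μ ν h₂ h₃ hμ hν A t ht => ?_⟩⟩
  · rw [cubeSliceLaw_eq_uniformOn d₁ h₂ h₃]
    exact (hasSubgaussianForms_cubeSliceFinset d₁ d₂ d₃ μ ν).uniformOn_real_linear_le
      (cubeSliceFinset_nonempty d₁ h₂ h₃) v t ht
  · rw [cubeSliceLaw_eq_uniformOn d₁ h₂ h₃]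
    refine uniformOn_real_quadratic_le (blockInvariant_cubeSliceFinset d₁ d₂ d₃ μ ν)
      (fun x hx i => ?_) (hasSubgaussianForms_cubeSliceFinset d₁ d₂ d₃ μ ν)
      (cubeSliceFinset_nonempty d₁ h₂ h₃) (blockMean_dotProduct_self_le hμ hν) A t ht
    rcases (mem_cubeSliceFinset.1 hx).1 i with h | h <;> simp [h]
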